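/- **Trees.** Let $n\ge 0$, $l,k_1,\dots,k_n\ge 0$. An $(l;k_1,\dots,k_n)$-tree is a planar rooted tree with $l$ legs labelled bijectively by $0,\dots,l-1$, with $n$ white vertices labelled bijectively by $1,\dots,n$, the $i$-th having $k_i$ inputs, and with further vertices that are either black, with at least two inputs, or special, with no input; no two black vertices are adjacent and no special vertex is adjacent to a black one. For a monoid $M$ and maps $f_i:M^{k_i}\to M$, a tree $w$ determines an operation $w(f_1,\dots,f_n):M^l\to M$: the legs are the variables, the $i$-th white vertex acts by $f_i$, black vertices by multiplication, special vertices by $1$. Let $B^l_{k_1,\dots,k_n}$ be the free abelian group on the $(l;k_1,\dots,k_n)$-trees, and $T^l_{k_1,\dots,k_n}$ the free abelian group on the trees without labels of the legs, included in $B^l_{k_1,\dots,k_n}$ by labelling the legs in the planar order. Let $\widehat B^l_{k_1,\dots,k_n}$ and $\widehat T^l_{k_1,\dots,k_n}$ be the subgroups spanned by the trees that have no special vertex attached to a white one and are not the tree consisting of a special root only. **Functoriality.** Let $\mathcal{IS}$ be the category with objects $\langle l-1\rangle=\{-1,0,\dots,l\}$, $l\ge0$, in which a morphism $\langle l-1\rangle\to\langle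 k-1\rangle$ is a map $g$ with $g(-1)=-1$, $g(l)=k$, together with a linear order on each fibre such that $-1$ is the least element of its fibre and $l$ the greatest of its fibre; the fibres of a composite are ordered lexicographically. For such $g$ and $f:M^k\to M$ put $$O_g(f)(a_0,\dots,a_{l-1})=\bar a_{-1}\, f(\bar a_0,\dots,\bar a_{k-1})\,\bar a_k,\qquad \bar a_j=\prod_{x\in g^{-1}(j)}a_x ,$$ the product taken in the order of the fibre, with $a_{-1}=a_l=1$. Via $w\mapsto O_g\bigl(w(O_{h_1}f_1,\dots,O_{h_n}f_n)\bigr)$, $B$ is a functor contravariant in the upper index $\langle l-1\rangle\in\mathcal{IS}$ and covariant in each lower index. Joyal's duality $\Delta\cong\mathcal I^{op}$, with $\mathcal I$ the category of finite intervals (endpoint-preserving monotone maps), composed with the inclusion $\mathcal I\subset\mathcal{IS}$ that gives fibres the inherited order, is a functor $j:\Delta\to\mathcal{IS}^{op}$, $[l]\mapsto\langle l-1\rangle$. By restriction along $j$ in the lower indices, $B$ becomes a functor $\mathcal{IS}^{op}\to[(\Delta^{op})^n,\mathrm{Ab}]$ (an $\mathcal S$-object in $n$-fold simplicial abelian groups);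 by restriction in the upper index also, $B$ is a cosimplicial $n$-fold simplicial abelian group $B^\bullet_{\bullet_1,\dots,\bullet_n}$, and $T^\bullet_{\bullet_1,\dots,\bullet_n}$ is a subobject of it. **Free $\mathcal S$-objects and totalization.** For a cocomplete category $C$, $F_{\mathcal S}:[\Delta,C]\to[\mathcal{IS}^{op},C]$ is the left adjoint of restriction along $j$; the monad of this adjunction on $[\Delta,C]$ is denoted by $F_{\mathcal S}$ as well. $\underline{\mathrm{Tot}}$ is the total chain complex of an $n$-fold simplicial abelian group (direct sums of unnormalized components, alternating sums of faces), applied degreewise in the upper index. $\overline{\mathrm{Tot}}$ is the total cochain complex of a cosimplicial chain complex: its degree-$m$ part is the product of the components of cosimplicial degree $l$ and chain degree $k$ with $l-k=m$, and its differential combines, with the usual signs, the alternating sum of the cofaces and the chain differential. Put $\mathcal B(n)=\overline{\mathrm{Tot}}\,\underline{\mathrm{Tot}}\,B^\bullet_{\bullet_1,\dots,\bullet_n}$ and $\mathcal T(n)=\overline{\mathrm{Tot}}\,\underline{\mathrm{Tot}}\,T^\bullet_{\bullet_1,\dots,\bullet_n}$. **Proposition.** For every $n\ge0$: 1. There is an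 isomorphism of $\mathcal S$-objects $e:F_{\mathcal S}(T^\bullet_{\bullet_1,\dots,\bullet_n})\cong B^\bullet_{\bullet_1,\dots,\bullet_n}$ in $n$-fold simplicial abelian groups whose composite with the unit $T\to F_{\mathcal S}T$ of the monad $F_{\mathcal S}$ is the inclusion $T\to B$. Likewise there is an isomorphism of $\mathcal S$-objects $e':F_{\mathcal S}(\underline{\mathrm{Tot}}\,T)\cong\underline{\mathrm{Tot}}\,B$ in chain complexes whose composite with the unit is $\underline{\mathrm{Tot}}$ of the inclusion. They induce isomorphisms of cochain complexes $$\mathcal B(n)\cong\overline{\mathrm{Tot}}\bigl(\underline{\mathrm{Tot}}(F_{\mathcal S}T^\bullet_{\bullet_1,\dots,\bullet_n})\bigr)\cong\overline{\mathrm{Tot}}\bigl(F_{\mathcal S}\,\underline{\mathrm{Tot}}(T^\bullet_{\bullet_1,\dots,\bullet_n})\bigr),$$ and under either of them the inclusion $\mathcal T(n)\to\mathcal B(n)$ is the map induced by the unit of $F_{\mathcal S}$. Explicitly, for all $l,k_1,\dots,k_n$ the map $$\bigoplus_{h\in\mathrm{Aut}_{\mathcal{IS}}\langle l-1\rangle}T^l_{k_1,\dots,k_n}\to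 B^l_{k_1,\dots,k_n},\qquad (t,h)\mapsto h^*t,$$ is an isomorphism, where $\mathrm{Aut}_{\mathcal{IS}}\langle l-1\rangle$ is the symmetric group on $l$ letters. 2. The same holds for $\widehat T$ and $\widehat B$ in place of $T$ and $B$, where now $\Delta$ is replaced in all indices by its subcategory $\Delta_{inj}$ of injective maps, $\mathcal{IS}$ by its subcategory of surjective maps, and $F_{\mathcal S}$ by the left adjoint of restriction along $j:\Delta_{inj}\to(\mathcal{IS}_{surj})^{op}$. The totalizations use only faces and cofaces and are unchanged. -/

import Mathlib

open CategoryTheory Opposite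

namespace NatOps

/-! ### The category of intervals with ordered fibres -/

/-- An object `⟨m - 1⟩ = {-1, 0, …, m - 1, m}`, recorded by the number `m` of its interior
points.  The points are the elements of `Fin (m + 2)`, shifted by one: `0` stands for `-1` and
`Fin.last (m + 1)` for `m`. -/
structure IS : Type where
  len : ℕ

/-- A map of intervals with a linear order on each fibre: `fib j` lists the elements of the fibre
over `j` in increasing order.  The endpoints are preserved, the left endpoint is minimal in its
fibre and the right endpoint is maximal in its fibre. -/
@[ext]
structure ISHom (m n : ℕ) : Type where
  toFun : Fin (m + 2) → Fin (n + 2)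
  fib : Fin (n + 2) → List (Fin (m + 2))
  mem_fib : ∀ j x, x ∈ fib j ↔ toFun x = j
  nodup : ∀ j, (fib j).Nodup
  head_fib : (fib 0).head? = some 0
  last_fib : (fib (Fin.last (n + 1))).getLast? = some (Fin.last (m + 1))

namespace ISHom

theorem ext_fib {m n : ℕ} {f g : ISHom m n} (h : f.fib = g.fib) : f = g := by
  refine ISHom.ext ?_ h
  funext x
  have := (f.mem_fib (f.toFun x) x).2 rfl
  rw [h] at this
  exact ((g.mem_fib _ _).1 this).symm

theorem toFun_zero {m n : ℕ} (f : ISHom m n) : f.toFun 0 = 0 :=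
  (f.mem_fib _ _).1 (List.mem_of_mem_head? (by rw [f.head_fib]; rfl))

theorem toFun_last {m n : ℕ} (f : ISHom m n) : f.toFun (Fin.last _) = Fin.last _ :=
  (f.mem_fib _ _).1 (List.mem_of_mem_getLast? (by rw [f.last_fib]; rfl))

theorem mem_fib_iff_of_toFun {m n : ℕ} {f g : ISHom m n} (h : ∀ x, f.toFun x = g.toFun x)
    (j x) : x ∈ f.fib j ↔ x ∈ g.fib j := by
  rw [f.mem_fib, g.mem_fib, h]

/-- The identity. -/
def id (m : ℕ) : ISHom m m where
  toFun x := x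
  fib j := [j]
  mem_fib := by simp
  nodup := by simp
  head_fib := rfl
  last_fib := rfl

/-- Composition: the fibre of `g ∘ f` over `j` is the ordered sum of the fibres of `f` over the
elements of the fibre of `g` over `j`. -/
def comp {m n p : ℕ} (f : ISHom m n) (g : ISHom n p) : ISHom m p where
  toFun x := g.toFun (f.toFun x)
  fib j := (g.fib j).flatMap f.fib
  mem_fib := by
    intro j x
    simp [f.mem_fib, g.mem_fib]
  nodup := by
    intro j
    rw [List.nodup_flatMap]
    refine ⟨fun x _ => f.nodup x, (g.nodup j).imp ?_⟩
    intro a b hab x hx hy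
    rw [f.mem_fib] at hx hy
    exact hab (hx.symm.trans hy)
  head_fib := by
    have h := g.head_fib
    cases hg : g.fib 0 with
    | nil => simp [hg] at h
    | cons a t =>
      rw [hg] at h
      simp only [List.head?_cons, Option.some.injEq] at h
      subst h
      rw [List.flatMap_cons, List.head?_append, f.head_fib]
      rfl
  last_fib := by
    have h := g.last_fib
    obtain ⟨t, ht⟩ := List.getLast?_eq_some_iff.1 h
    rw [ht, List.flatMap_append, List.getLast?_append]
    simp [f.last_fib]

end ISHom

instance : Category IS where
  Hom a b := ISHom a.len b.len
  id a := ISHom.id a.len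
  comp f g := ISHom.comp f g
  id_comp f := ISHom.ext_fib (by funext j; simp [ISHom.comp, ISHom.id])
  comp_id f := ISHom.ext_fib (by funext j; simp [ISHom.comp, ISHom.id])
  assoc f g h := ISHom.ext_fib (by funext j; simp [ISHom.comp, List.flatMap_assoc])

/-- A sorted-fibre interval map built from a monotone map preserving the endpoints. -/
def ISHom.ofMono {m n : ℕ} (f : Fin (m + 2) → Fin (n + 2)) (h0 : f 0 = 0)
    (hl : f (Fin.last _) = Fin.last _) : ISHom m n where
  toFun := f
  fib j := (List.finRange (m + 2)).filter (fun x => f x = j)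
  mem_fib := by simp
  nodup j := (List.nodup_finRange _).filter _
  head_fib := by
    rw [List.finRange_succ, List.filter_cons]
    simp [h0]
  last_fib := by
    rw [List.finRange_succ_last, List.filter_append]
    simp [hl]

theorem pairwise_flatMap_ofMono {m n : ℕ} (f : Fin (m + 2) → Fin (n + 2)) (hf : Monotone f)
    (L : List (Fin (n + 2))) (hL : L.Pairwise (· < ·)) :
    (L.flatMap (fun j => (List.finRange (m + 2)).filter (fun x => f x = j))).Pairwise (· < ·) := by
  rw [List.pairwise_flatMap]
  refine ⟨fun a _ => (List.pairwise_lt_finRange _).filter _, hL.imp ?_⟩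
  intro a b hab x hx y hy
  simp at hx hy
  subst hx hy
  exact lt_of_not_ge fun h => absurd (hf h) (not_le.2 hab)

theorem eq_of_pairwise {m : ℕ} {L L' : List (Fin m)} (h : L.Pairwise (· < ·))
    (h' : L'.Pairwise (· < ·)) (H : ∀ x, x ∈ L ↔ x ∈ L') : L = L' :=
  List.Perm.eq_of_pairwise (fun _ _ _ _ h1 h2 => absurd h1 (not_lt.2 h2.le)) h h'
    ((List.perm_ext_iff_of_nodup (h.imp ne_of_lt) (h'.imp ne_of_lt)).2 H)

/-- Joyal's duality followed by the inclusion of intervals into intervals with ordered fibres: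
`[m]` goes to `⟨m - 1⟩`, and a monotone map `φ : [m] → [n]` goes to the monotone map
`⟨n - 1⟩ → ⟨m - 1⟩` with `x ↦ min {y | x ≤ φ y}` (the right endpoint if there is no such `y`), in
the shifted coordinates; fibres carry the order inherited from the source. -/
def joyal : SimplexCategoryᵒᵖ ⥤ IS where
  obj a := ⟨a.unop.len⟩
  map {_ _} φ := ISHom.ofMono (SimplexCategory.II.map' φ.unop.toOrderHom)
    (SimplexCategory.II.map'_zero _) (SimplexCategory.II.map'_last _)
  map_id a := by
    refine ISHom.ext_fib ?_
    funext j
    refine eq_of_pairwise ((List.pairwise_lt_finRange _).filter _) (List.pairwise_singleton _ _) ?_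
    intro x
    exact ISHom.mem_fib_iff_of_toFun (g := ISHom.id _)
      (fun y => SimplexCategory.II.map'_id y) j x
  map_comp {a b c} f g := by
    refine ISHom.ext_fib ?_
    funext j
    refine eq_of_pairwise ((List.pairwise_lt_finRange _).filter _)
      (pairwise_flatMap_ofMono _ (SimplexCategory.II.monotone_map' _) _
        ((List.pairwise_lt_finRange _).filter _)) ?_
    intro x
    exact ISHom.mem_fib_iff_of_toFun (g := ISHom.comp (ISHom.ofMono _ _ _) (ISHom.ofMono _ _ _))
      (fun y => (SimplexCategory.II.map'_map' _ _ y).symm) j x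

/-! ### Trees -/

/-- Planar trees as words.  A word is a product of factors; a factor is either a leg carrying a
label in `α`, or a white vertex with label `i` and arity `k i` whose inputs are again words.
A word with one factor stands for that factor, a word with at least two factors for a black vertex
with the factors as its inputs (so that no two black vertices are adjacent), and the empty word
for a special vertex (so that special vertices are never attached to black ones). -/
inductive Word {n : ℕ} (k : Fin n → ℕ) (α : Type) : Type
  | nil : Word k α
  | leg (a : α) (w : Word k α) : Word k α
  | white (i : Fin n) (c : Fin (k i) → Word k α) (w : Word k α) : Word k α

namespace Word

variable {n : ℕ} {k : Fin n → ℕ} {α : Type}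

/-- Concatenation: black vertices and special vertices created on the way are absorbed. -/
def append : Word k α → Word k α → Word k α
  | nil, v => v
  | leg a w, v => leg a (append w v)
  | white i c w, v => white i c (append w v)

instance : Monoid (Word k α) where
  mul := append
  one := nil
  one_mul _ := rfl
  mul_one w := by
    change append w nil = w
    induction w with
    | nil => rfl
    | leg a w ih => simp [append, ih]
    | white i c w _ ih => simp [append, ih]
  mul_assoc u v w := by
    change append (append u v) w = append u (append v w)
    induction u with
    | nil => rfl
    | leg a u ih => simp [append, ih]
    | white i c u _ ih => simp [append, ih]

theorem nil_eq_one : (nil : Word k α) = 1 := rfl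
theorem leg_mul (a : α) (u v : Word k α) : leg a u * v = leg a (u * v) := rfl
theorem white_mul (i : Fin n) (c) (u v : Word k α) : white i c u * v = white i c (u * v) := rfl

/-- The tree with one leg and no vertex. -/
def var (a : α) : Word k α := leg a nil

/-- Grafting words onto a white vertex. -/
def vertex (i : Fin n) (c : Fin (k i) → Word k α) : Word k α := white i c nil

theorem leg_eq (a : α) (w : Word k α) : leg a w = var a * w := rfl
theorem white_eq (i : Fin n) (c) (w : Word k α) : white i c w = vertex i c * w := rfl

/-- The operation determined by a tree: legs are decorated by elements `v a` of a monoid, white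
vertices by operations `ops i`, black vertices by multiplication, special vertices by the unit. -/
def eval {M : Type} [Monoid M] (ops : ∀ i, (Fin (k i) → M) → M) (v : α → M) : Word k α → M
  | nil => 1
  | leg a w => v a * eval ops v w
  | white i c w => ops i (fun j => eval ops v (c j)) * eval ops v w

section
variable {M : Type} [Monoid M] (ops : ∀ i, (Fin (k i) → M) → M) (v : α → M)

theorem eval_one : eval ops v (1 : Word k α) = 1 := rfl

theorem eval_mul (u w : Word k α) : eval ops v (u * w) = eval ops v u * eval ops v w := by
  induction u with
  | nil => exact (one_mul _).symm
  | leg a u ih => rw [leg_mul, eval, eval, ih, mul_assoc]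
  | white i c u _ ih => rw [white_mul, eval, eval, ih, mul_assoc]

/-- Evaluation as a monoid homomorphism. -/
def evalHom : Word k α →* M where
  toFun := eval ops v
  map_one' := rfl
  map_mul' := eval_mul ops v

theorem evalHom_apply (w : Word k α) : evalHom ops v w = eval ops v w := rfl

theorem eval_var (a : α) : eval ops v (var a) = v a := mul_one _

theorem eval_vertex (i : Fin n) (c : Fin (k i) → Word k α) :
    eval ops v (vertex i c) = ops i (fun j => eval ops v (c j)) := mul_one _

theorem map_eval {N : Type} [Monoid N] (Φ : M →* N) (ops' : ∀ i, (Fin (k i) → N) → N)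
    (h : ∀ i c, Φ (ops i c) = ops' i (fun j => Φ (c j))) (w : Word k α) :
    Φ (eval ops v w) = eval ops' (fun a => Φ (v a)) w := by
  induction w with
  | nil => exact Φ.map_one
  | leg a u ih => rw [eval, eval, map_mul, ih]
  | white i c u ih1 ih => rw [eval, eval, map_mul, ih, h]; simp only [ih1]

end

theorem eval_self (w : Word k α) : eval vertex var w = w := by
  induction w with
  | nil => rfl
  | leg a u ih => rw [eval, ih]; rfl
  | white i c u ih1 ih => rw [eval, ih]; simp only [ih1]; rfl

/-- The labels of the legs, in the planar (counterclockwise) order. -/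
def legs : Word k α → List α
  | nil => []
  | leg a w => a :: legs w
  | white _ c w => (List.ofFn fun j => legs (c j)).flatten ++ legs w

/-- The labels of the white vertices, with repetition. -/
def whites : Word k α → List (Fin n)
  | nil => []
  | leg _ w => whites w
  | white i c w => i :: ((List.ofFn fun j => whites (c j)).flatten ++ whites w)

/-- No special vertex is attached to a white vertex. -/
def NoStub : Word k α → Prop
  | nil => True
  | leg _ w => NoStub w
  | white _ c w => (∀ j, c j ≠ nil ∧ NoStub (c j)) ∧ NoStub w

end Word

/-! ### The operations `O_g` -/

section Og

variable {M : Type} [Monoid M]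

/-- `a₀, …, a_{l-1}` extended by `a_{-1} = a_l = 1`. -/
def ext {l : ℕ} (a : Fin l → M) : Fin (l + 2) → M :=
  Fin.cons 1 (Fin.snoc a 1 : Fin (l + 1) → M)

/-- `ā_j`: the product of the `a_x` over the fibre of `g` over `j`, in the order of the fibre. -/
def bar {l k : ℕ} (g : ISHom l k) (a : Fin l → M) (j : Fin (k + 2)) : M :=
  ((g.fib j).map (ext a)).prod

/-- `O_g(f)(a₀, …, a_{l-1}) = ā_{-1} · f(ā₀, …, ā_{k-1}) · ā_k`. -/
def opO {l k : ℕ} (g : ISHom l k) (f : (Fin k → M) → M) (a : Fin l → M) : M :=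
  bar g a 0 * f (fun i => bar g a i.castSucc.succ) * bar g a (Fin.last (k + 1))

theorem ext_zero {l : ℕ} (a : Fin l → M) : ext a 0 = 1 := rfl
theorem ext_last {l : ℕ} (a : Fin l → M) : ext a (Fin.last (l + 1)) = 1 := by
  rw [ext, ← Fin.succ_last, Fin.cons_succ, Fin.snoc_last]
theorem ext_mid {l : ℕ} (a : Fin l → M) (i : Fin l) : ext a i.castSucc.succ = a i := by
  rw [ext, Fin.cons_succ, Fin.snoc_castSucc]

theorem bar_id {l : ℕ} (a : Fin l → M) (j) : bar (ISHom.id l) a j = ext a j := by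
  simp [bar, ISHom.id]

theorem opO_id {l : ℕ} (f : (Fin l → M) → M) (a : Fin l → M) : opO (ISHom.id l) f a = f a := by
  simp only [opO, bar_id, ext_zero, ext_last, ext_mid, one_mul, mul_one]

theorem prod_flatMap_map {ι κ : Type} (L : List ι) (F : ι → List κ) (a : κ → M) :
    ((L.flatMap F).map a).prod = (L.map fun j => ((F j).map a).prod).prod := by
  induction L with
  | nil => rfl
  | cons x t ih => simp [ih]

theorem bar_comp {l k p : ℕ} (g : ISHom l k) (h : ISHom k p) (a : Fin l → M) (j) :
    bar (g.comp h) a j = ((h.fib j).map (bar g a)).prod :=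
  prod_flatMap_map _ _ _

theorem fin_cases3 {k : ℕ} (x : Fin (k + 2)) :
    x = 0 ∨ x = Fin.last (k + 1) ∨ ∃ i : Fin k, x = i.castSucc.succ := by
  induction x using Fin.cases with
  | zero => exact Or.inl rfl
  | succ x =>
    induction x using Fin.lastCases with
    | last => exact Or.inr (Or.inl (Fin.succ_last _))
    | cast i => exact Or.inr (Or.inr ⟨i, rfl⟩)

/-- Values of a list over the fibre, when the endpoints may only be hit by endpoints. -/
theorem map_bar_eq {l k : ℕ} (g : ISHom l k) (a : Fin l → M) (L : List (Fin (k + 2)))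
    (h0 : (0 : Fin (k + 2)) ∉ L) (hl : Fin.last (k + 1) ∉ L) :
    L.map (bar g a) = L.map (ext fun i => bar g a i.castSucc.succ) := by
  refine List.map_congr_left fun x hx => ?_
  rcases fin_cases3 x with rfl | rfl | ⟨i, rfl⟩
  · exact absurd hx h0
  · exact absurd hx hl
  · rw [ext_mid]

theorem opO_comp {l k p : ℕ} (g : ISHom l k) (h : ISHom k p) (f : (Fin p → M) → M)
    (a : Fin l → M) : opO (g.comp h) f a = opO g (opO h f) a := by
  have h0l' : (0 : Fin (p + 2)) ≠ Fin.last (p + 1) := (Fin.last_pos).ne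
  have e0 : bar (g.comp h) a 0 = bar g a 0 * bar h (fun i => bar g a i.castSucc.succ) 0 := by
    rw [bar_comp, bar.eq_def h]
    have hh := h.head_fib
    have hn := h.nodup 0
    have hm := h.mem_fib 0
    cases hg : h.fib 0 with
    | nil => simp [hg] at hh
    | cons x t =>
      rw [hg] at hh hn hm
      simp only [List.head?_cons, Option.some.injEq] at hh
      subst hh
      rw [List.nodup_cons] at hn
      rw [List.map_cons, List.map_cons, List.prod_cons, List.prod_cons, ext_zero, one_mul,
        map_bar_eq g a t hn.1]
      intro hx
      have := (hm _).1 (List.mem_cons_of_mem _ hx)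
      rw [h.toFun_last] at this
      exact h0l' this.symm
  have el : bar (g.comp h) a (Fin.last _) =
      bar h (fun i => bar g a i.castSucc.succ) (Fin.last _) * bar g a (Fin.last _) := by
    rw [bar_comp, bar.eq_def h]
    have hn := h.nodup (Fin.last _)
    have hm := h.mem_fib (Fin.last _)
    obtain ⟨t, ht⟩ := List.getLast?_eq_some_iff.1 h.last_fib
    rw [ht] at hn hm ⊢
    rw [List.nodup_append] at hn
    have h1 : Fin.last (k + 1) ∉ t := fun hx => hn.2.2 _ hx _ (List.mem_singleton_self _) rfl
    have h2 : (0 : Fin (k + 2)) ∉ t := by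
      intro hx
      have := (hm _).1 (List.mem_append_left _ hx)
      rw [h.toFun_zero] at this
      exact h0l' this
    simp only [List.map_append, List.prod_append, List.map_cons, List.map_nil, List.prod_cons,
      List.prod_nil, mul_one, ext_last, map_bar_eq g a t h2 h1]
  have em : ∀ i : Fin p, bar (g.comp h) a i.castSucc.succ =
      bar h (fun i => bar g a i.castSucc.succ) i.castSucc.succ := by
    intro i
    rw [bar_comp, bar.eq_def h, map_bar_eq]
    · rw [h.mem_fib, h.toFun_zero]
      exact (Fin.succ_ne_zero _).symm
    · rw [h.mem_fib, h.toFun_last, ← Fin.succ_last]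
      intro hh
      exact (Fin.castSucc_lt_last i).ne (Fin.succ_injective _ hh).symm
  rw [opO, e0, el]
  simp only [em, opO, mul_assoc]

theorem map_opO {N : Type} [Monoid N] (Φ : M →* N) {l k : ℕ} (g : ISHom l k)
    (f : (Fin k → M) → M) (f' : (Fin k → N) → N)
    (hf : ∀ c, Φ (f c) = f' (fun j => Φ (c j))) (a : Fin l → M) :
    Φ (opO g f a) = opO g f' (fun i => Φ (a i)) := by
  have hext : ∀ x, Φ (ext a x) = ext (fun i => Φ (a i)) x := by
    intro x
    rcases fin_cases3 x with rfl | rfl | ⟨i, rfl⟩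
    · exact Φ.map_one
    · rw [ext_last, ext_last, map_one]
    · rw [ext_mid, ext_mid]
  have hbar : ∀ j, Φ (bar g a j) = bar g (fun i => Φ (a i)) j := by
    intro j
    rw [bar, map_list_prod, List.map_map, bar]
    exact congrArg _ (List.map_congr_left fun x _ => hext x)
  simp only [opO, map_mul, hf, hbar]

theorem prod_finRange {l : ℕ} (F : Fin (l + 2) → M) :
    ((List.finRange (l + 2)).map F).prod =
      F 0 * (List.ofFn fun i : Fin l => F i.castSucc.succ).prod * F (Fin.last (l + 1)) := by
  rw [← List.ofFn_eq_map, List.ofFn_succ, List.prod_cons, List.ofFn_succ', List.concat_eq_append,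
    List.prod_append, List.prod_singleton, Fin.succ_last, mul_assoc]

theorem prod_ext {l : ℕ} (a : Fin l → M) :
    ((List.finRange (l + 2)).map (ext a)).prod = (List.ofFn a).prod := by
  rw [prod_finRange, ext_zero, ext_last, one_mul, mul_one]
  simp only [ext_mid]

/-- For `f` the product of its inputs, `O_g(f)` is the product over all fibres. -/
theorem opO_prod {l k : ℕ} (g : ISHom l k) (a : Fin l → M) :
    opO g (fun c => (List.ofFn c).prod) a =
      (((List.finRange (k + 2)).flatMap g.fib).map (ext a)).prod := by
  rw [prod_flatMap_map, prod_finRange]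
  rfl

/-- In the commutative case, `O_g` of a product is the product. -/
theorem opO_comm {N : Type} [CommMonoid N] {l k : ℕ} (g : ISHom l k) (ω : N) (a : Fin l → N) :
    opO g (fun c => ω * (List.ofFn c).prod) a = ω * (List.ofFn a).prod := by
  have h1 : opO g (fun c => ω * (List.ofFn c).prod) a =
      ω * opO g (fun c => (List.ofFn c).prod) a := by
    simp only [opO]
    rw [mul_left_comm, mul_assoc]
  have hp : ((List.finRange (k + 2)).flatMap g.fib).Perm (List.finRange (l + 2)) := by
    refine (List.perm_ext_iff_of_nodup ?_ (List.nodup_finRange _)).2 fun x => ?_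
    · rw [List.nodup_flatMap]
      refine ⟨fun j _ => g.nodup j, (List.nodup_finRange _).imp ?_⟩
      intro i j hij x hi hj
      rw [g.mem_fib] at hi hj
      exact hij (hi.symm.trans hj)
    · simp only [List.mem_flatMap, List.mem_finRange, true_and, iff_true]
      exact ⟨_, (g.mem_fib _ x).2 rfl⟩
  rw [h1, opO_prod, (hp.map _).prod_eq, prod_ext]

/-- For order preserving `g` with the inherited order on the fibres, `O_g` of a product is the
product. -/
theorem opO_planar {l k : ℕ} (g : ISHom l k)
    (hg : (List.finRange (k + 2)).flatMap g.fib = List.finRange (l + 2)) (a : Fin l → M) :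
    opO g (fun c => (List.ofFn c).prod) a = (List.ofFn a).prod := by
  rw [opO_prod, hg, prod_ext]

end Og

/-! ### The action on trees -/

section Act

variable {n : ℕ}

/-- Vertex insertion of the operations `O_g` into a tree, on both sides: for a tree `w` with
operation `O` this is the tree of the operation `f ↦ O_g (O (O_{h₁} f₁, …, O_{hₙ} fₙ))`. -/
def act {k k' : Fin n → ℕ} {l l' : ℕ} (g : ISHom l' l) (h : ∀ i, ISHom (k i) (k' i))
    (w : Word k (Fin l)) : Word k' (Fin l') :=
  opO g (fun a => w.eval (fun i => opO (h i) (Word.vertex i)) a) Word.var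

theorem act_id {k : Fin n → ℕ} {l : ℕ} (w : Word k (Fin l)) :
    act (ISHom.id l) (fun i => ISHom.id (k i)) w = w := by
  have : (fun i => opO (ISHom.id (k i)) (Word.vertex (k := k) (α := Fin l) i)) =
      fun i => Word.vertex i := by
    funext i c
    exact opO_id _ _
  rw [act, opO_id, this, Word.eval_self]

theorem eval_act {M : Type} [Monoid M] {k k' : Fin n → ℕ} {l l' : ℕ} (g : ISHom l' l)
    (h : ∀ i, ISHom (k i) (k' i)) (w : Word k (Fin l)) (ops : ∀ i, (Fin (k' i) → M) → M)
    (v : Fin l' → M) :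
    (act g h w).eval ops v = opO g (fun a => w.eval (fun i => opO (h i) (ops i)) a) v := by
  have := map_opO (Word.evalHom ops v) g
    (fun a => w.eval (fun i => opO (h i) (Word.vertex i)) a)
    (fun a => w.eval (fun i => opO (h i) (ops i)) a) (fun c => ?_) Word.var
  · refine this.trans ?_
    simp only [Word.evalHom_apply, Word.eval_var]
  · rw [Word.map_eval _ _ (Word.evalHom ops v) (fun i => opO (h i) (ops i))]
    intro i c
    rw [map_opO (Word.evalHom ops v) (h i) _ (ops i)]
    intro c
    exact Word.eval_vertex _ _ _ _

theorem act_comp {k k' k'' : Fin n → ℕ} {l l' l'' : ℕ} (g : ISHom l' l) (g' : ISHom l'' l')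
    (h : ∀ i, ISHom (k i) (k' i)) (h' : ∀ i, ISHom (k' i) (k'' i)) (w : Word k (Fin l)) :
    act (g'.comp g) (fun i => (h i).comp (h' i)) w = act g' h' (act g h w) := by
  rw [act, act, opO_comp]
  congr 1
  funext a
  rw [eval_act]
  congr 1
  funext b
  congr 1
  funext i c
  exact opO_comp _ _ _ _

/-- Every label `0, …, l - 1` occurs on exactly one leg and every label `0, …, n - 1` on exactly
one white vertex: the trees of type `(l; k₁, …, kₙ)`. -/
structure IsTree {k : Fin n → ℕ} {l : ℕ} (w : Word k (Fin l)) : Prop where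
  legs : w.legs.Perm (List.finRange l)
  whites : w.whites.Perm (List.finRange n)

/-- The legs are labelled in the planar order; such a tree is the same as an unlabelled tree. -/
def IsPlanar {k : Fin n → ℕ} {l : ℕ} (w : Word k (Fin l)) : Prop :=
  w.legs = List.finRange l

/-- There are no stubs, and the tree is not the exceptional tree with a special root. -/
def IsHat {k : Fin n → ℕ} {l : ℕ} (w : Word k (Fin l)) : Prop :=
  w ≠ Word.nil ∧ w.NoStub

theorem eval_comm {N : Type} [CommMonoid N] {k : Fin n → ℕ} {α : Type} (ω : Fin n → N)
    (v : α → N) (w : Word k α) :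
    w.eval (fun i c => ω i * (List.ofFn c).prod) v = (w.whites.map ω).prod * (w.legs.map v).prod := by
  induction w with
  | nil => exact (one_mul 1).symm
  | leg a w ih =>
    rw [Word.eval, ih, Word.whites, Word.legs, List.map_cons, List.prod_cons, mul_left_comm]
  | white i c w ih1 ih =>
    rw [Word.eval, ih, Word.whites, Word.legs]
    simp only [ih1]
    simp only [List.map_cons, List.prod_cons, List.map_append, List.prod_append,
      List.map_flatten, List.prod_flatten, List.map_ofFn, Function.comp_def, List.prod_ofFn,
      Finset.prod_mul_distrib]
    simp only [mul_assoc, mul_left_comm]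

theorem prod_singleton_multiset {X : Type} (L : List X) :
    (L.map fun x => Multiplicative.ofAdd ({x} : Multiset X)).prod =
      Multiplicative.ofAdd (L : Multiset X) := by
  induction L with
  | nil => rfl
  | cons x L ih =>
    rw [List.map_cons, List.prod_cons, ih, ← ofAdd_add, Multiset.singleton_add, Multiset.cons_coe]

theorem act_weight {N : Type} [CommMonoid N] {k k' : Fin n → ℕ} {l l' : ℕ} (g : ISHom l' l)
    (h : ∀ i, ISHom (k i) (k' i)) {w : Word k (Fin l)} (hw : IsTree w) (ω : Fin n → N)
    (v : Fin l' → N) :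
    ((act g h w).whites.map ω).prod * ((act g h w).legs.map v).prod =
      ((List.finRange n).map ω).prod * ((List.finRange l').map v).prod := by
  have e : (fun i => opO (h i) fun c : Fin (k' i) → N => ω i * (List.ofFn c).prod) =
      fun i c => ω i * (List.ofFn c).prod := by
    funext i c
    exact opO_comm _ _ _
  have e' : (fun a : Fin l → N => w.eval (fun i c => ω i * (List.ofFn c).prod) a) =
      fun c => ((List.finRange n).map ω).prod * (List.ofFn c).prod := by
    funext a
    rw [eval_comm, (hw.whites.map ω).prod_eq, (hw.legs.map a).prod_eq, List.ofFn_eq_map]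
  rw [← eval_comm, eval_act, e, e', opO_comm, List.ofFn_eq_map]

theorem IsTree.act {k k' : Fin n → ℕ} {l l' : ℕ} (g : ISHom l' l)
    (h : ∀ i, ISHom (k i) (k' i)) {w : Word k (Fin l)} (hw : IsTree w) : IsTree (NatOps.act g h w) := by
  constructor
  · have := act_weight g h hw (N := Multiplicative (Multiset (Fin l'))) (fun _ => 1)
      (fun x => Multiplicative.ofAdd {x})
    rw [prod_singleton_multiset, prod_singleton_multiset] at this
    simp only [List.map_const', List.prod_replicate, one_pow, one_mul] at this
    exact Multiset.coe_eq_coe.1 (Multiplicative.ofAdd.injective this)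
  · have := act_weight g h hw (N := Multiplicative (Multiset (Fin n)))
      (fun x => Multiplicative.ofAdd {x}) (fun _ => 1)
    rw [prod_singleton_multiset, prod_singleton_multiset] at this
    simp only [List.map_const', List.prod_replicate, one_pow, mul_one] at this
    exact Multiset.coe_eq_coe.1 (Multiplicative.ofAdd.injective this)

theorem eval_legs {M : Type} [Monoid M] {k : Fin n → ℕ} {α : Type} (v : α → M) (w : Word k α) :
    w.eval (fun _ c => (List.ofFn c).prod) v = (w.legs.map v).prod := by
  induction w with
  | nil => rfl
  | leg a w ih => rw [Word.eval, ih, Word.legs, List.map_cons, List.prod_cons]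
  | white i c w ih1 ih =>
    rw [Word.eval, ih, Word.legs]
    simp only [ih1, List.map_append, List.prod_append, List.map_flatten, List.prod_flatten,
      List.map_ofFn, Function.comp_def]

theorem IsPlanar.act {k k' : Fin n → ℕ} {l l' : ℕ} (g : ISHom l' l)
    (hg : (List.finRange (l + 2)).flatMap g.fib = List.finRange (l' + 2))
    (h : ∀ i, ISHom (k i) (k' i))
    (hh : ∀ i, (List.finRange (k' i + 2)).flatMap (h i).fib = List.finRange (k i + 2))
    {w : Word k (Fin l)} (hw : IsPlanar w) : IsPlanar (NatOps.act g h w) := by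
  have e : (fun i => opO (h i) fun c : Fin (k' i) → FreeMonoid (Fin l') =>
      (List.ofFn c).prod) = fun _ c => (List.ofFn c).prod := by
    funext i c
    exact opO_planar _ (hh i) _
  have e' : (fun a : Fin l → FreeMonoid (Fin l') => w.eval (fun _ c => (List.ofFn c).prod) a) =
      fun c => (List.ofFn c).prod := by
    funext a
    rw [eval_legs, hw, List.ofFn_eq_map]
  have h1 := eval_act g h w (fun _ c => (List.ofFn c).prod) (FreeMonoid.of (α := Fin l'))
  rw [e, e', opO_planar _ hg, eval_legs, List.ofFn_eq_map] at h1
  have h2 : ∀ L : List (Fin l'), (L.map FreeMonoid.of).prod = FreeMonoid.ofList L := by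
    intro L
    induction L with
    | nil => rfl
    | cons x L ih => rw [List.map_cons, List.prod_cons, ih]; rfl
  rw [h2, h2] at h1
  exact FreeMonoid.ofList.injective h1

theorem Word.mul_eq_nil {k : Fin n → ℕ} {α : Type} {u w : Word k α} (h : u * w = Word.nil) :
    u = Word.nil := by
  cases u with
  | nil => rfl
  | leg a u => cases h
  | white i c u => cases h

theorem Word.NoStub.mul {k : Fin n → ℕ} {α : Type} {u w : Word k α} (hu : u.NoStub)
    (hw : w.NoStub) : (u * w).NoStub := by
  induction u with
  | nil => exact hw
  | leg a u ih => exact ih hu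
  | white i c u _ ih => exact ⟨hu.1, ih hu.2⟩

theorem Word.NoStub.prod {k : Fin n → ℕ} {α : Type} {L : List (Word k α)}
    (hL : ∀ w ∈ L, w.NoStub) : L.prod.NoStub := by
  induction L with
  | nil => trivial
  | cons x L ih =>
    rw [List.prod_cons]
    exact (hL x (by simp)).mul (ih fun w hw => hL w (by simp [hw]))

theorem noStub_bar {k : Fin n → ℕ} {α : Type} {l m : ℕ} (g : ISHom l m)
    {a : Fin l → Word k α} (ha : ∀ i, (a i).NoStub) (j) : (bar g a j).NoStub := by
  refine Word.NoStub.prod fun w hw => ?_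
  obtain ⟨x, -, rfl⟩ := List.mem_map.1 hw
  rcases fin_cases3 x with rfl | rfl | ⟨i, rfl⟩
  · trivial
  · rw [ext_last]; trivial
  · rw [ext_mid]; exact ha i

theorem bar_ne_nil {k : Fin n → ℕ} {α : Type} {l m : ℕ} (g : ISHom l m)
    (hg : Function.Surjective g.toFun) {a : Fin l → Word k α} (ha : ∀ i, a i ≠ Word.nil)
    (j : Fin m) : bar g a j.castSucc.succ ≠ Word.nil := by
  have h0 : (0 : Fin (l + 2)) ∉ g.fib j.castSucc.succ := by
    rw [g.mem_fib, g.toFun_zero]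
    exact (Fin.succ_ne_zero _).symm
  have hl : Fin.last (l + 1) ∉ g.fib j.castSucc.succ := by
    rw [g.mem_fib, g.toFun_last, ← Fin.succ_last]
    intro hh
    exact (Fin.castSucc_lt_last j).ne (Fin.succ_injective _ hh).symm
  obtain ⟨x, hx⟩ := hg j.castSucc.succ
  rw [← g.mem_fib] at hx
  rw [bar]
  cases hL : g.fib j.castSucc.succ with
  | nil => simp [hL] at hx
  | cons y t =>
    rw [hL] at h0 hl
    rw [List.map_cons, List.prod_cons]
    intro h
    have := Word.mul_eq_nil h
    rcases fin_cases3 y with rfl | rfl | ⟨i, rfl⟩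
    · simp at h0
    · simp at hl
    · rw [ext_mid] at this
      exact ha i this

theorem isHat_opO {k : Fin n → ℕ} {α : Type} {l m : ℕ} (g : ISHom l m)
    (hg : Function.Surjective g.toFun) (F : (Fin m → Word k α) → Word k α)
    (hF : ∀ c, (∀ i, c i ≠ Word.nil ∧ (c i).NoStub) → F c ≠ Word.nil ∧ (F c).NoStub)
    {a : Fin l → Word k α} (ha : ∀ i, a i ≠ Word.nil ∧ (a i).NoStub) :
    opO g F a ≠ Word.nil ∧ (opO g F a).NoStub := by
  have hb := hF (fun i => bar g a i.castSucc.succ) fun i =>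
    ⟨bar_ne_nil g hg (fun i => (ha i).1) i, noStub_bar g (fun i => (ha i).2) _⟩
  refine ⟨fun h => ?_, ((noStub_bar g (fun i => (ha i).2) _).mul hb.2).mul
    (noStub_bar g (fun i => (ha i).2) _)⟩
  rw [opO] at h
  have h1 := Word.mul_eq_nil h
  have h2 := Word.mul_eq_nil h1
  rw [h2, Word.nil_eq_one, one_mul] at h1
  exact hb.1 h1

theorem IsHat.act {k k' : Fin n → ℕ} {l l' : ℕ} (g : ISHom l' l)
    (hg : Function.Surjective g.toFun) (h : ∀ i, ISHom (k i) (k' i))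
    (hh : ∀ i, Function.Surjective (h i).toFun) {w : Word k (Fin l)} (hw : IsHat w) :
    IsHat (NatOps.act g h w) := by
  refine isHat_opO g hg _ (fun a ha => ?_) fun i => ⟨by rintro ⟨⟩, trivial⟩
  have key : ∀ u : Word k (Fin l), u.NoStub →
      (u.eval (fun i => opO (h i) (Word.vertex i)) a).NoStub ∧
        (u ≠ Word.nil → u.eval (fun i => opO (h i) (Word.vertex i)) a ≠ Word.nil) := by
    intro u hu
    induction u with
    | nil => exact ⟨trivial, fun h => absurd rfl h⟩
    | leg x u ih =>
      exact ⟨(ha x).2.mul (ih hu).1, fun _ h => (ha x).1 (Word.mul_eq_nil h)⟩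
    | white i c u ih1 ih =>
      have := isHat_opO (h i) (hh i) (Word.vertex i)
        (fun c hc => ⟨by rintro ⟨⟩, hc, trivial⟩)
        (a := fun j => (c j).eval (fun i => opO (h i) (Word.vertex i)) a)
        (fun j => ⟨(ih1 j (hu.1 j).2).2 (hu.1 j).1, (ih1 j (hu.1 j).2).1⟩)
      exact ⟨this.2.mul (ih hu.2).1, fun _ h => this.1 (Word.mul_eq_nil h)⟩
  exact ⟨(key w hw.2).2 hw.1, (key w hw.2).1⟩

theorem joyal_planar {a b : SimplexCategoryᵒᵖ} (φ : a ⟶ b) :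
    (List.finRange (b.unop.len + 2)).flatMap (joyal.map φ).fib =
      List.finRange (a.unop.len + 2) := by
  refine eq_of_pairwise (pairwise_flatMap_ofMono _ (SimplexCategory.II.monotone_map' _) _
    (List.pairwise_lt_finRange _)) (List.pairwise_lt_finRange _) fun x => ?_
  exact ⟨fun _ => List.mem_finRange _, fun _ => List.mem_flatMap.2
    ⟨_, List.mem_finRange _, ((joyal.map φ).mem_fib _ x).2 rfl⟩⟩

end Act

/-! ### The functors of trees -/

/-- Surjective maps of intervals. -/
def surj : MorphismProperty IS := fun _ _ f => Function.Surjective (ISHom.toFun f)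

instance : surj.IsMultiplicative where
  id_mem _ := Function.surjective_id
  comp_mem _ _ hf hg := hg.comp hf

/-- The wide subcategory of surjective maps. -/
abbrev ISsurj : Type := WideSubcategory surj

/-- The restriction of `joyal` to injective monotone maps. -/
def joyalInj : SemiSimplexCategoryᵒᵖ ⥤ ISsurj where
  obj a := ⟨joyal.obj (SemiSimplexCategory.toSimplexCategory.op.obj a)⟩
  map {a b} φ := ⟨joyal.map (SemiSimplexCategory.toSimplexCategory.op.map φ), by
    intro y
    induction y using Fin.lastCases with
    | last => exact ⟨_, SimplexCategory.II.map'_last _⟩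
    | cast y =>
      refine ⟨(SemiSimplexCategory.homEquiv φ.unop y).castSucc,
        (SimplexCategory.II.map'_eq_castSucc_iff _ _ _).2 ⟨le_rfl, fun i hi => ?_⟩⟩
      exact Fin.castSucc_lt_castSucc_iff.2 ((SemiSimplexCategory.homEquiv φ.unop).strictMono hi)⟩
  map_id a := by
    apply WideSubcategory.hom_ext
    exact (SemiSimplexCategory.toSimplexCategory.op ⋙ joyal).map_id a
  map_comp f g := by
    apply WideSubcategory.hom_ext
    exact (SemiSimplexCategory.toSimplexCategory.op ⋙ joyal).map_comp f g

/-- A class `P` of trees that is stable under the operations `O_g` for `g` in `D` acting on the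
upper index and for `h` in `E` acting on the lower indices, as a functor of these indices. -/
def treeFunctor {n : ℕ} {D E : Type} [Category.{0} D] [Category.{0} E]
    (u : D ⥤ ISᵒᵖ) (v : E ⥤ (Fin n → IS))
    (P : ∀ (k : Fin n → ℕ) (l : ℕ), Word k (Fin l) → Prop)
    (hP : ∀ {X Y : D} {k k' : E} (g : X ⟶ Y) (h : k ⟶ k')
      (w : Word (fun i => (v.obj k i).len) (Fin (u.obj X).unop.len)), P _ _ w →
      P _ _ (act (u.map g).unop (v.map h) w)) : D ⥤ E ⥤ Type :=
  Functor.curryObj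
    { obj X := {w : Word (fun i => (v.obj X.2 i).len) (Fin (u.obj X.1).unop.len) // P _ _ w}
      map {_ _} f := TypeCat.ofHom fun w => ⟨act (u.map f.1).unop (v.map f.2) w.1, hP _ _ _ w.2⟩
      map_id X := by
        apply ConcreteCategory.hom_ext
        intro w
        apply Subtype.ext
        change act (u.map (𝟙 X.1)).unop (v.map (𝟙 X.2)) w.1 = w.1
        rw [u.map_id, v.map_id]
        exact act_id w.1
      map_comp {_ _ _} f f' := by
        apply ConcreteCategory.hom_ext
        intro w
        apply Subtype.ext
        change act (u.map (f.1 ≫ f'.1)).unop (v.map (f.2 ≫ f'.2)) w.1 = _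
        rw [u.map_comp, v.map_comp]
        exact act_comp _ _ _ _ w.1 }

/-- Linearization of a set-valued functor of an upper and a lower index. -/
noncomputable abbrev linearize {D E : Type} [Category.{0} D] [Category.{0} E]
    (F : D ⥤ E ⥤ Type) : D ⥤ E ⥤ AddCommGrpCat.{0} :=
  F ⋙ (Functor.whiskeringRight E Type AddCommGrpCat).obj AddCommGrpCat.free

/-- `n` simplicial directions. -/
abbrev LowerIdx (n : ℕ) : Type := Fin n → SimplexCategoryᵒᵖ

/-- `n` semi-simplicial directions. -/
abbrev LowerIdxInj (n : ℕ) : Type := Fin n → SemiSimplexCategoryᵒᵖ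

/-- `n`-fold simplicial abelian groups. -/
abbrev MultiSimp (n : ℕ) : Type 1 := LowerIdx n ⥤ AddCommGrpCat.{0}

/-- `n`-fold semi-simplicial abelian groups. -/
abbrev MultiSemiSimp (n : ℕ) : Type 1 := LowerIdxInj n ⥤ AddCommGrpCat.{0}

/-- Labelled trees. -/
def treesS (n : ℕ) : ISᵒᵖ ⥤ LowerIdx n ⥤ Type :=
  treeFunctor (𝟭 _) (Functor.pi fun _ => joyal) (fun _ _ w => IsTree w)
    (fun _ _ _ hw => hw.act _ _)

/-- Unlabelled trees, as the labelled ones with the planar labelling. -/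
def planarTrees (n : ℕ) : SimplexCategory ⥤ LowerIdx n ⥤ Type :=
  treeFunctor joyal.rightOp (Functor.pi fun _ => joyal) (fun _ _ w => IsTree w ∧ IsPlanar w)
    (fun g h _ hw => ⟨hw.1.act _ _, hw.2.act _ (joyal_planar g.op) _ fun i => joyal_planar (h i)⟩)

/-- Labelled trees without stubs, different from the exceptional tree. -/
def hatTreesS (n : ℕ) : ISsurjᵒᵖ ⥤ LowerIdxInj n ⥤ Type :=
  treeFunctor (wideSubcategoryInclusion surj).op
    (Functor.pi fun _ => joyalInj ⋙ wideSubcategoryInclusion surj) (fun _ _ w => IsTree w ∧ IsHat w)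
    (fun g h _ hw => ⟨hw.1.act _ _, hw.2.act _ g.unop.property _ fun i => (joyalInj.map (h i)).property⟩)

/-- Unlabelled trees without stubs, different from the exceptional tree. -/
def hatPlanarTrees (n : ℕ) : SemiSimplexCategory ⥤ LowerIdxInj n ⥤ Type :=
  treeFunctor (joyalInj.rightOp ⋙ (wideSubcategoryInclusion surj).op)
    (Functor.pi fun _ => joyalInj ⋙ wideSubcategoryInclusion surj)
    (fun _ _ w => (IsTree w ∧ IsHat w) ∧ IsPlanar w)
    (fun g h _ hw => ⟨⟨hw.1.1.act _ _, hw.1.2.act _ (joyalInj.map g.op).property _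
        fun i => (joyalInj.map (h i)).property⟩,
      hw.2.act _ (joyal_planar (SemiSimplexCategory.toSimplexCategory.map g).op) _
        fun i => joyal_planar (SemiSimplexCategory.toSimplexCategory.op.map (h i))⟩)

noncomputable section

/-- `B^•_{•₁,…,•ₙ}` with its structure of an `S`-object. -/
def BS (n : ℕ) : ISᵒᵖ ⥤ MultiSimp n := linearize (treesS n)

/-- `B^•_{•₁,…,•ₙ}`. -/
def B (n : ℕ) : SimplexCategory ⥤ MultiSimp n := joyal.rightOp ⋙ BS n

/-- `T^•_{•₁,…,•ₙ}`. -/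
def T (n : ℕ) : SimplexCategory ⥤ MultiSimp n := linearize (planarTrees n)

/-- Labelling the legs of an unlabelled tree in the planar order. -/
def inclTrees (n : ℕ) : planarTrees n ⟶ joyal.rightOp ⋙ treesS n where
  app l := { app k := TypeCat.ofHom fun w => ⟨w.1, w.2.1⟩
             naturality := fun _ _ _ => by
              apply ConcreteCategory.hom_ext
              intro w
              apply Subtype.ext
              have e : joyal.rightOp.map (𝟙 l) = 𝟙 (joyal.rightOp.obj l) := joyal.rightOp.map_id l
              change act (joyal.rightOp.map (𝟙 l)).unop _ w.1 = act (𝟙 (joyal.rightOp.obj l)).unop _ w.1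
              rw [e] }
  naturality := fun _ _ _ => rfl

/-- The inclusion of `T` into `B`. -/
def incl (n : ℕ) : T n ⟶ B n := Functor.whiskerRight (inclTrees n) _

/-- `B̂^•_{•₁,…,•ₙ}` with its structure of a semi-cosimplicial `S`-object. -/
def hatBS (n : ℕ) : ISsurjᵒᵖ ⥤ MultiSemiSimp n := linearize (hatTreesS n)

/-- `B̂^•_{•₁,…,•ₙ}`. -/
def hatB (n : ℕ) : SemiSimplexCategory ⥤ MultiSemiSimp n := joyalInj.rightOp ⋙ hatBS n

/-- `T̂^•_{•₁,…,•ₙ}`. -/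
def hatT (n : ℕ) : SemiSimplexCategory ⥤ MultiSemiSimp n := linearize (hatPlanarTrees n)

/-- Labelling the legs of an unlabelled tree in the planar order, without stubs. -/
def hatInclTrees (n : ℕ) : hatPlanarTrees n ⟶ joyalInj.rightOp ⋙ hatTreesS n where
  app l := { app k := TypeCat.ofHom fun w => ⟨w.1, w.2.1⟩
             naturality := fun _ _ _ => by
              apply ConcreteCategory.hom_ext
              intro w
              apply Subtype.ext
              have e : (joyalInj.rightOp ⋙ (wideSubcategoryInclusion surj).op).map (𝟙 l) = 𝟙 ((joyalInj.rightOp ⋙ (wideSubcategoryInclusion surj).op).obj l) := (joyalInj.rightOp ⋙ (wideSubcategoryInclusion surj).op).map_id l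
              change act ((joyalInj.rightOp ⋙ (wideSubcategoryInclusion surj).op).map (𝟙 l)).unop _ w.1 = act (𝟙 ((joyalInj.rightOp ⋙ (wideSubcategoryInclusion surj).op).obj l)).unop _ w.1
              rw [e] }
  naturality := fun _ _ _ => rfl

/-- The inclusion of `T̂` into `B̂`. -/
def hatIncl (n : ℕ) : hatT n ⟶ hatB n := Functor.whiskerRight (hatInclTrees n) _

/-! ### Free `S`-objects -/

section FreeS

open Limits

variable (C : Type 1) [Category.{0} C] [HasColimitsOfSize.{0, 0} C]

/-- The free `S`-object on a cosimplicial object: the left adjoint of the restriction along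
`Δ ≅ Iᵒᵖ → (IS)ᵒᵖ`. -/
def freeS : (SimplexCategory ⥤ C) ⥤ (ISᵒᵖ ⥤ C) := joyal.rightOp.lan

/-- `freeS` is left adjoint to the restriction. -/
def freeSAdj : freeS C ⊣ (Functor.whiskeringLeft _ _ C).obj joyal.rightOp :=
  joyal.rightOp.lanAdjunction C

/-- The monad `F_S` on cosimplicial objects. -/
def monadS : Monad (SimplexCategory ⥤ C) := (freeSAdj C).toMonad

/-- The free semi-cosimplicial `S`-object on a semi-cosimplicial object. -/
def hatFreeS : (SemiSimplexCategory ⥤ C) ⥤ (ISsurjᵒᵖ ⥤ C) := joyalInj.rightOp.lan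

/-- `hatFreeS` is left adjoint to the restriction. -/
def hatFreeSAdj : hatFreeS C ⊣ (Functor.whiskeringLeft _ _ C).obj joyalInj.rightOp :=
  joyalInj.rightOp.lanAdjunction C

/-- The monad `F_S` on semi-cosimplicial objects. -/
def hatMonadS : Monad (SemiSimplexCategory ⥤ C) := (hatFreeSAdj C).toMonad

end FreeS

/-- For an object `Y` with right actions of the groups `H = Aut(⟨l - 1⟩)ᵒᵖ` and a map `α : X ⟶ Y`,
the map `⊕_{h ∈ H} X → Y`, `(x, h) ↦ α(x) · h`, in a given degree and multidegree. -/
def orbitMap {D G E : Type} [Category.{0} D] [Category.{0} G] [Category.{0} E]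
    {j : D ⥤ Gᵒᵖ} {X : D ⥤ E ⥤ AddCommGrpCat.{0}} {Y : Gᵒᵖ ⥤ E ⥤ AddCommGrpCat.{0}}
    (α : X ⟶ j ⋙ Y) (d : D) (e : E) :
    (Aut (j.obj d).unop →₀ (X.obj d).obj e) →+ (Y.obj (j.obj d)).obj e :=
  Finsupp.liftAddHom fun h => ((Y.map h.hom.op).app e).hom.comp ((α.app d).app e).hom

/-! ### Totalizations -/

theorem alt_sum {A : Type} [AddCommGroup A] (F : ℕ → ℕ → A) (N : ℕ)
    (h : ∀ j < N, ∀ j' ≤ j, F j j' = F j' (j + 1)) :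
    ∑ j ∈ Finset.range N, ∑ j' ∈ Finset.range (N + 1), (-1 : ℤ) ^ (j + j') • F j j' = 0 := by
  rw [← Finset.sum_product']
  refine Finset.sum_involution
    (fun p _ => if p.2 ≤ p.1 then (p.2, p.1 + 1) else (p.2 - 1, p.1)) ?_ ?_ ?_ ?_
  · rintro ⟨j, j'⟩ hp
    simp only [Finset.mem_product, Finset.mem_range] at hp
    dsimp only
    split_ifs with hj
    · rw [h j hp.1 j' hj, ← add_smul]
      convert zero_smul ℤ _
      ring
    · obtain ⟨t, rfl⟩ : ∃ t, j' = t + 1 := ⟨j' - 1, by omega⟩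
      rw [Nat.add_sub_cancel, h t (by omega) j (by omega), ← add_smul]
      convert zero_smul ℤ _
      ring
  · rintro ⟨j, j'⟩ hp - heq
    dsimp only at heq
    split_ifs at heq <;> simp only [Prod.mk.injEq] at heq <;> omega
  · rintro ⟨j, j'⟩ hp
    simp only [Finset.mem_product, Finset.mem_range] at hp
    dsimp only
    split_ifs <;> simp only [Finset.mem_product, Finset.mem_range] <;> omega
  · rintro ⟨j, j'⟩ hp
    dsimp only
    by_cases hj : j' ≤ j
    · rw [if_pos hj]
      dsimp only
      rw [if_neg (by omega), Nat.add_sub_cancel]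
    · rw [if_neg hj]
      dsimp only
      rw [if_pos (by omega)]
      simp only [Prod.mk.injEq, true_and]
      omega

section Lower
variable {n : ℕ}

/-- `k + e_i`. -/
def bump (k : Fin n → ℕ) (i : Fin n) : Fin n → ℕ := fun a => if a = i then k a + 1 else k a

theorem sum_bump (k : Fin n → ℕ) (i : Fin n) : ∑ a, bump k i a = ∑ a, k a + 1 := by
  have : bump k i = fun a => k a + if a = i then 1 else 0 := by
    funext a
    unfold bump
    split_ifs <;> rfl
  rw [this, Finset.sum_add_distrib]
  simp

/-- The coface `δ_j` in the direction `i`, and the identity in the other directions. -/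
def face (k : Fin n → ℕ) (i : Fin n) (j : ℕ) (a : Fin n) :
    SemiSimplexCategory.mk (k a) ⟶ SemiSimplexCategory.mk (bump k i a) :=
  SemiSimplexCategory.homEquiv.symm <| OrderEmbedding.ofStrictMono
    (fun x => ⟨if a = i ∧ j ≤ x.val then x.val + 1 else x.val, by
      have := x.isLt
      simp only [bump] at this ⊢
      split_ifs at this ⊢ <;> omega⟩)
    (by
      intro x y h
      rw [Fin.lt_def] at h ⊢
      dsimp only
      split_ifs <;> omega)

/-- The object of multidegree `k`. -/
def lowerObj (k : Fin n → ℕ) : LowerIdxInj n := fun a => op (SemiSimplexCategory.mk (k a))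

/-- The `j`-th face operator in the direction `i`. -/
def lowerFace (k : Fin n → ℕ) (i : Fin n) (j : ℕ) : lowerObj (bump k i) ⟶ lowerObj k :=
  fun a => (face k i j a).op

variable (X : MultiSemiSimp n)

/-- Degree `m` of the total complex: the sum of the (finitely many) components of multidegree
`(k₁, …, kₙ)` with `k₁ + ⋯ + kₙ = m`. -/
abbrev LowerX (m : ℕ) : Type := ∀ k : {k : Fin n → ℕ // ∑ a, k a = m}, X.obj (lowerObj k.1)

/-- The differential `∑ᵢ ± ∑ⱼ (-1)ʲ ∂ⱼ` with the sign `(-1)^{k₁ + ⋯ + k_{i-1}}`. -/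
def lowerD (m : ℕ) : LowerX X (m + 1) →+ LowerX X m :=
  AddMonoidHom.pi fun k => ∑ i : Fin n, ∑ j ∈ Finset.range (k.1 i + 2),
    ((-1 : ℤ) ^ (∑ a ∈ Finset.univ.filter (· < i), k.1 a + j)) •
      (X.map (lowerFace k.1 i j)).hom.comp
        (Pi.evalAddMonoidHom (fun k : {k : Fin n → ℕ // ∑ a, k a = m + 1} => X.obj (lowerObj k.1))
          ⟨bump k.1 i, by rw [sum_bump, k.2]⟩)

theorem lowerD_apply (m : ℕ) (x : LowerX X (m + 1)) (k) :
    lowerD X m x k = ∑ i : Fin n, ∑ j ∈ Finset.range (k.1 i + 2),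
    ((-1 : ℤ) ^ (∑ a ∈ Finset.univ.filter (· < i), k.1 a + j)) •
      (X.map (lowerFace k.1 i j)).hom (x ⟨bump k.1 i, by rw [sum_bump, k.2]⟩) := by
  simp [lowerD]

/-- Transport of a component along a morphism of multidegrees. -/
theorem lower_congr {m : ℕ} (x : LowerX X m) {k k₁ k₂ : Fin n → ℕ} (h : k₁ = k₂)
    (h₁ : ∑ a, k₁ a = m) (h₂ : ∑ a, k₂ a = m) (f : lowerObj k₁ ⟶ lowerObj k)
    (g : lowerObj k₂ ⟶ lowerObj k)
    (hfg : ∀ a (y : Fin (k a + 1)), (SemiSimplexCategory.homEquiv (f a).unop y).val =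
      (SemiSimplexCategory.homEquiv (g a).unop y).val) :
    (X.map f).hom (x ⟨k₁, h₁⟩) = (X.map g).hom (x ⟨k₂, h₂⟩) := by
  subst h
  congr 3
  funext a
  apply Quiver.Hom.unop_inj
  apply SemiSimplexCategory.hom_ext
  ext y
  exact hfg a y

theorem face_val (k : Fin n → ℕ) (i : Fin n) (j : ℕ) (a : Fin n) (y : Fin (k a + 1)) :
    (SemiSimplexCategory.homEquiv (face k i j a) y).val =
      if a = i ∧ j ≤ y.val then y.val + 1 else y.val := rfl

theorem face_face_val (k : Fin n → ℕ) (i i' : Fin n) (j j' : ℕ) (a : Fin n) (y : Fin (k a + 1)) :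
    (SemiSimplexCategory.homEquiv
      ((lowerFace (bump k i) i' j' ≫ lowerFace k i j : lowerObj _ ⟶ lowerObj k) a).unop y).val =
      if a = i' ∧ j' ≤ (if a = i ∧ j ≤ y.val then y.val + 1 else y.val) then
        (if a = i ∧ j ≤ y.val then y.val + 1 else y.val) + 1
      else (if a = i ∧ j ≤ y.val then y.val + 1 else y.val) := rfl

theorem sum_lt_bump (k : Fin n → ℕ) (i i' : Fin n) :
    ∑ a ∈ Finset.univ.filter (· < i'), bump k i a =
      ∑ a ∈ Finset.univ.filter (· < i'), k a + if i < i' then 1 else 0 := by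
  have : bump k i = fun a => k a + if a = i then 1 else 0 := by
    funext a
    unfold bump
    split_ifs <;> rfl
  rw [this, Finset.sum_add_distrib]
  congr 1
  rw [Finset.sum_ite_eq']
  simp

theorem bump_comm (k : Fin n → ℕ) (i i' : Fin n) : bump (bump k i) i' = bump (bump k i') i := by
  funext a
  simp only [bump]
  split_ifs <;> rfl

/-- `lowerD` squares to zero. -/
theorem lowerD_lowerD (m : ℕ) (x : LowerX X (m + 1 + 1)) :
    lowerD X m (lowerD X (m + 1) x) = 0 := by
  funext k
  let s : Fin n → ℕ := fun i => ∑ a ∈ Finset.univ.filter (· < i), k.1 a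
  let F : Fin n → ℕ → Fin n → ℕ → X.obj (lowerObj k.1) := fun i j i' j' =>
    (X.map (lowerFace (bump k.1 i) i' j' ≫ lowerFace k.1 i j)).hom
      (x ⟨bump (bump k.1 i) i', by rw [sum_bump, sum_bump, k.2]⟩)
  let G : Fin n → Fin n → X.obj (lowerObj k.1) := fun i i' =>
    ∑ j ∈ Finset.range (k.1 i + 2), ∑ j' ∈ Finset.range (bump k.1 i i' + 2),
      (-1 : ℤ) ^ (s i + j + (s i' + (if i < i' then 1 else 0) + j')) • F i j i' j'
  have key : lowerD X m (lowerD X (m + 1) x) k = ∑ i, ∑ i', G i i' := by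
    rw [lowerD_apply]
    simp only [lowerD_apply, map_sum, map_zsmul, Finset.smul_sum, smul_smul, ← pow_add,
      sum_lt_bump, G, F, X.map_comp]
    refine Finset.sum_congr rfl fun i _ => ?_
    rw [Finset.sum_comm]
    rfl
  have hne : ∀ i i', i ≠ i' → G i i' + G i' i = 0 := by
    intro i i' hi
    have hF : ∀ j j', F i j i' j' = F i' j' i j := by
      intro j j'
      refine lower_congr X x (bump_comm _ _ _) _ _ _ _ fun a y => ?_
      rw [face_face_val, face_face_val]
      by_cases h1 : a = i
      · subst h1
        simp [hi]
      · simp [h1]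
    have hb : bump k.1 i i' = k.1 i' := by simp [bump, hi.symm]
    have hb' : bump k.1 i' i = k.1 i := by simp [bump, hi]
    simp only [G, hb, hb']
    rw [Finset.sum_comm, ← Finset.sum_add_distrib]
    refine Finset.sum_eq_zero fun j' _ => ?_
    rw [← Finset.sum_add_distrib]
    refine Finset.sum_eq_zero fun j _ => ?_
    rw [hF, ← add_smul]
    convert zero_smul ℤ _
    rcases lt_or_gt_of_ne hi with h | h
    · rw [if_pos h, if_neg (not_lt.2 h.le)]
      ring
    · rw [if_pos h, if_neg (not_lt.2 h.le)]
      ring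
  have heq : ∀ i, G i i = 0 := by
    intro i
    have hb : bump k.1 i i = k.1 i + 1 := by simp [bump]
    have := alt_sum (fun j j' => F i j i j') (k.1 i + 2) (fun j _ j' hj => by
      refine lower_congr X x rfl _ _ _ _ fun a y => ?_
      rw [face_face_val, face_face_val]
      by_cases h1 : a = i
      · simp only [h1, true_and]
        split_ifs <;> omega
      · simp [h1])
    simp only [G, hb]
    rw [← this]
    refine Finset.sum_congr rfl fun j _ => Finset.sum_congr rfl fun j' _ => ?_
    rw [if_neg (lt_irrefl i)]
    congr 1
    rw [show s i + j + (s i + 0 + j') = 2 * s i + (j + j') by ring, pow_add, pow_mul]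
    simp
  rw [key, ← Finset.sum_product', Pi.zero_apply]
  refine Finset.sum_involution (fun p _ => (p.2, p.1)) ?_ ?_ ?_ ?_
  · rintro ⟨i, i'⟩ -
    by_cases h : i = i'
    · subst h
      dsimp only
      rw [heq, add_zero]
    · exact hne i i' h
  · rintro ⟨i, i'⟩ - h0 h
    simp only [Prod.mk.injEq] at h
    obtain ⟨rfl, -⟩ := h
    exact h0 (heq _)
  · simp
  · simp

/-- The map induced on total complexes. -/
def lowerMap {X Y : MultiSemiSimp n} (f : X ⟶ Y) (m : ℕ) : LowerX X m →+ LowerX Y m :=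
  AddMonoidHom.pi fun k => (f.app (lowerObj k.1)).hom.comp
    (Pi.evalAddMonoidHom (fun k : {k : Fin n → ℕ // ∑ a, k a = m} => X.obj (lowerObj k.1)) k)

theorem lowerMap_comm {X Y : MultiSemiSimp n} (f : X ⟶ Y) (m : ℕ) (x : LowerX X (m + 1)) :
    lowerD Y m (lowerMap f (m + 1) x) = lowerMap f m (lowerD X m x) := by
  funext k
  change lowerD Y m _ k = (f.app (lowerObj k.1)).hom (lowerD X m x k)
  rw [lowerD_apply, lowerD_apply]
  simp only [map_sum, map_zsmul]
  refine Finset.sum_congr rfl fun i _ => Finset.sum_congr rfl fun j _ => ?_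
  congr 1
  exact (ConcreteCategory.congr_hom (f.naturality (lowerFace k.1 i j)) _).symm

/-- The total chain complex of an `n`-fold semi-simplicial abelian group. -/
def lowerTotObj : ChainComplex AddCommGrpCat.{0} ℕ :=
  ChainComplex.of (fun m => AddCommGrpCat.of (LowerX X m))
    (fun m => AddCommGrpCat.ofHom (lowerD X m))
    (fun m => by
      apply ConcreteCategory.hom_ext
      intro x
      exact lowerD_lowerD X m x)

theorem lowerTotObj_d (m : ℕ) :
    (lowerTotObj X).d (m + 1) m = AddCommGrpCat.ofHom (lowerD X m) :=
  ChainComplex.of_d (fun m => AddCommGrpCat.of (LowerX X m))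
    (fun m => AddCommGrpCat.ofHom (lowerD X m)) m

/-- The total chain complex as a functor. -/
def lowerTot (n : ℕ) : MultiSemiSimp n ⥤ ChainComplex AddCommGrpCat.{0} ℕ where
  obj X := lowerTotObj X
  map {X Y} f := ChainComplex.ofHom
    (fun m => AddCommGrpCat.ofHom (lowerMap f m))
    (fun m => by
      rw [lowerTotObj_d, lowerTotObj_d]
      apply ConcreteCategory.hom_ext
      intro x
      exact lowerMap_comm f m x)
  map_id X := by
    ext m x
    rfl
  map_comp f g := by
    ext m x
    rfl

end Lower
section Upper

variable (X : SemiSimplexCategory ⥤ ChainComplex AddCommGrpCat.{0} ℕ)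

/-- The coface `δ_j : [l] → [l + 1]`, for `j ≤ l + 1`. -/
def coface (l j : ℕ) : SemiSimplexCategory.mk l ⟶ SemiSimplexCategory.mk (l + 1) :=
  SemiSimplexCategory.homEquiv.symm <| OrderEmbedding.ofStrictMono
    (fun x => ⟨if j ≤ x.val then x.val + 1 else x.val, by
      have := x.isLt
      dsimp only at this ⊢
      split_ifs <;> omega⟩)
    (by
      intro x y h
      rw [Fin.lt_def] at h ⊢
      dsimp only
      split_ifs <;> omega)

theorem coface_comm (l j j' : ℕ) (h : j' ≤ j) :
    coface l j ≫ coface (l + 1) j' = coface l j' ≫ coface (l + 1) (j + 1) := by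
  apply SemiSimplexCategory.hom_ext
  ext x
  change (if j' ≤ (if j ≤ x.val then x.val + 1 else x.val) then
    (if j ≤ x.val then x.val + 1 else x.val) + 1 else (if j ≤ x.val then x.val + 1 else x.val)) =
    (if j + 1 ≤ (if j' ≤ x.val then x.val + 1 else x.val) then
    (if j' ≤ x.val then x.val + 1 else x.val) + 1 else (if j' ≤ x.val then x.val + 1 else x.val))
  split_ifs <;> omega

/-- The alternating sum of the cofaces. -/
def delta (l : ℕ) : X.obj (.mk l) ⟶ X.obj (.mk (l + 1)) :=
  ∑ j ∈ Finset.range (l + 2), (-1 : ℤ) ^ j • X.map (coface l j)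

theorem delta_delta (l : ℕ) : delta X l ≫ delta X (l + 1) = 0 := by
  have := alt_sum (fun j j' => X.map (coface l j ≫ coface (l + 1) j')) (l + 2)
    (fun j _ j' h => by rw [coface_comm l j j' h])
  rw [← this]
  simp only [delta, Preadditive.sum_comp, Preadditive.comp_sum, Preadditive.zsmul_comp,
    Preadditive.comp_zsmul, Finset.smul_sum, smul_smul, ← pow_add, X.map_comp]
  rw [Finset.sum_comm]
  refine Finset.sum_congr rfl fun j _ => Finset.sum_congr rfl fun j' _ => ?_
  rw [add_comm j' j]

theorem delta_naturality {X Y : SemiSimplexCategory ⥤ ChainComplex AddCommGrpCat.{0} ℕ}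
    (f : X ⟶ Y) (l : ℕ) : f.app (.mk l) ≫ delta Y l = delta X l ≫ f.app (.mk (l + 1)) := by
  simp only [delta, Preadditive.sum_comp, Preadditive.comp_sum, Preadditive.zsmul_comp,
    Preadditive.comp_zsmul, f.naturality]

/-- Degree `m` of the total complex: the product of the `X^l_k` with `l - k = m`. -/
abbrev UpperX (m : ℤ) : Type :=
  ∀ p : {p : ℕ × ℕ // (p.1 : ℤ) - p.2 = m}, (X.obj (.mk p.1.1)).X p.1.2

/-- The part of the differential induced by the cosimplicial structure; the sign `(-1)^{l + k}`
makes it anticommute with the chain differentials. -/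
def upperDelta (m : ℤ) : ∀ p : {p : ℕ × ℕ // (p.1 : ℤ) - p.2 = m + 1},
    UpperX X m →+ (X.obj (.mk p.1.1)).X p.1.2
  | ⟨(0, _), _⟩ => 0
  | ⟨(l + 1, k), h⟩ => ((-1 : ℤ) ^ (l + k)) • ((delta X l).f k).hom.comp
      (Pi.evalAddMonoidHom (fun p : {p : ℕ × ℕ // (p.1 : ℤ) - p.2 = m} => (X.obj (.mk p.1.1)).X p.1.2)
        ⟨(l, k), by push_cast at h ⊢; omega⟩)

/-- The part of the differential induced by the chain differentials. -/
def upperPartial (m : ℤ) (p : {p : ℕ × ℕ // (p.1 : ℤ) - p.2 = m + 1}) :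
    UpperX X m →+ (X.obj (.mk p.1.1)).X p.1.2 :=
  ((X.obj (.mk p.1.1)).d (p.1.2 + 1) p.1.2).hom.comp
    (Pi.evalAddMonoidHom (fun p : {p : ℕ × ℕ // (p.1 : ℤ) - p.2 = m} => (X.obj (.mk p.1.1)).X p.1.2)
      ⟨(p.1.1, p.1.2 + 1), by have := p.2; push_cast; omega⟩)

/-- The differential `a ↦ δ a - ∂ a`. -/
def upperD (m : ℤ) : UpperX X m →+ UpperX X (m + 1) :=
  AddMonoidHom.pi fun p => upperDelta X m p - upperPartial X m p

theorem upperD_zero (m : ℤ) (a : UpperX X m) (k : ℕ) (h) :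
    upperD X m a ⟨(0, k), h⟩ =
      - ((X.obj (.mk 0)).d (k + 1) k).hom (a ⟨(0, k + 1), by push_cast at h ⊢; omega⟩) := by
  simp [upperD, upperDelta, upperPartial]

theorem upperD_succ (m : ℤ) (a : UpperX X m) (l k : ℕ) (h) :
    upperD X m a ⟨(l + 1, k), h⟩ =
      ((-1 : ℤ) ^ (l + k)) • ((delta X l).f k).hom (a ⟨(l, k), by push_cast at h ⊢; omega⟩)
      - ((X.obj (.mk (l + 1))).d (k + 1) k).hom
        (a ⟨(l + 1, k + 1), by push_cast at h ⊢; omega⟩) := by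
  simp [upperD, upperDelta, upperPartial]

theorem upperD_upperD (m : ℤ) (a : UpperX X m) : upperD X (m + 1) (upperD X m a) = 0 := by
  have hdd : ∀ (l k : ℕ) (y : (X.obj (.mk l)).X (k + 1 + 1)),
      ((X.obj (.mk l)).d (k + 1) k).hom (((X.obj (.mk l)).d (k + 1 + 1) (k + 1)).hom y) = 0 :=
    fun l k y => ConcreteCategory.congr_hom ((X.obj (.mk l)).d_comp_d (k + 1 + 1) (k + 1) k) y
  have hcomm : ∀ (l k : ℕ) (y : (X.obj (.mk l)).X (k + 1)),
      ((X.obj (.mk (l + 1))).d (k + 1) k).hom (((delta X l).f (k + 1)).hom y) =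
        ((delta X l).f k).hom (((X.obj (.mk l)).d (k + 1) k).hom y) :=
    fun l k y => ConcreteCategory.congr_hom ((delta X l).comm (k + 1) k) y
  have hδδ : ∀ (l k : ℕ) (y : (X.obj (.mk l)).X k),
      ((delta X (l + 1)).f k).hom (((delta X l).f k).hom y) = 0 :=
    fun l k y => ConcreteCategory.congr_hom (congrArg (fun f => f.f k) (delta_delta X l)) y
  funext p
  obtain ⟨⟨l, k⟩, h⟩ := p
  rw [Pi.zero_apply]
  match l, h with
  | 0, h => rw [upperD_zero, upperD_zero, map_neg, hdd, neg_zero, neg_zero]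
  | 1, h =>
    rw [upperD_succ, upperD_zero, upperD_succ, map_sub, map_zsmul, map_neg, hdd, hcomm]
    simp only [smul_neg, sub_zero]
    rw [← neg_add']
    refine neg_eq_zero.2 ?_
    rw [← add_smul]
    convert zero_smul ℤ _
    ring
  | l + 2, h =>
    rw [upperD_succ, upperD_succ, upperD_succ, map_sub, map_sub, map_zsmul, map_zsmul, hδδ, hdd,
      hcomm, smul_zero, zero_sub, sub_zero, smul_neg, ← neg_add']
    refine neg_eq_zero.2 ?_
    rw [← add_smul]
    convert zero_smul ℤ _
    ring

/-- The map induced on total complexes. -/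
def upperMap {X Y : SemiSimplexCategory ⥤ ChainComplex AddCommGrpCat.{0} ℕ}
    (f : X ⟶ Y) (m : ℤ) : UpperX X m →+ UpperX Y m :=
  AddMonoidHom.pi fun p => ((f.app (.mk p.1.1)).f p.1.2).hom.comp
    (Pi.evalAddMonoidHom
      (fun p : {p : ℕ × ℕ // (p.1 : ℤ) - p.2 = m} => (X.obj (.mk p.1.1)).X p.1.2) p)

theorem upperMap_comm {X Y : SemiSimplexCategory ⥤ ChainComplex AddCommGrpCat.{0} ℕ}
    (f : X ⟶ Y) (m : ℤ) (a : UpperX X m) :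
    upperD Y m (upperMap f m a) = upperMap f (m + 1) (upperD X m a) := by
  have hd : ∀ (l k : ℕ) (y : (X.obj (.mk l)).X (k + 1)),
      ((Y.obj (.mk l)).d (k + 1) k).hom (((f.app (.mk l)).f (k + 1)).hom y) =
        ((f.app (.mk l)).f k).hom (((X.obj (.mk l)).d (k + 1) k).hom y) :=
    fun l k y => ConcreteCategory.congr_hom ((f.app (.mk l)).comm (k + 1) k) y
  have hδ : ∀ (l k : ℕ) (y : (X.obj (.mk l)).X k),
      ((delta Y l).f k).hom (((f.app (.mk l)).f k).hom y) =
        ((f.app (.mk (l + 1))).f k).hom (((delta X l).f k).hom y) :=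
    fun l k y => ConcreteCategory.congr_hom (congrArg (fun f => f.f k) (delta_naturality f l)) y
  funext p
  obtain ⟨⟨l, k⟩, h⟩ := p
  match l, h with
  | 0, h =>
    refine (upperD_zero Y m _ k h).trans (Eq.trans ?_
      (congrArg ((f.app (.mk 0)).f k).hom (upperD_zero X m a k h)).symm)
    rw [map_neg]
    exact congrArg Neg.neg (hd _ _ _)
  | l + 1, h =>
    refine (upperD_succ Y m _ l k h).trans (Eq.trans ?_
      (congrArg ((f.app (.mk (l + 1))).f k).hom (upperD_succ X m a l k h)).symm)
    rw [map_sub, map_zsmul, ← hδ, ← hd]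
    rfl

/-- The total cochain complex of a semi-cosimplicial chain complex. -/
def upperTotObj : CochainComplex AddCommGrpCat.{0} ℤ :=
  CochainComplex.of (fun m => AddCommGrpCat.of (UpperX X m))
    (fun m => AddCommGrpCat.ofHom (upperD X m))
    (fun m => by
      apply ConcreteCategory.hom_ext
      intro a
      exact upperD_upperD X m a)

theorem upperTotObj_d (m : ℤ) :
    (upperTotObj X).d m (m + 1) = AddCommGrpCat.ofHom (upperD X m) :=
  CochainComplex.of_d (fun m => AddCommGrpCat.of (UpperX X m))
    (fun m => AddCommGrpCat.ofHom (upperD X m)) m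

end Upper

/-- The total cochain complex as a functor. -/
def upperTot : (SemiSimplexCategory ⥤ ChainComplex AddCommGrpCat.{0} ℕ) ⥤
    CochainComplex AddCommGrpCat.{0} ℤ where
  obj X := upperTotObj X
  map {X Y} f := CochainComplex.ofHom
    (fun m => AddCommGrpCat.ofHom (upperMap f m))
    (fun m => by
      rw [upperTotObj_d, upperTotObj_d]
      apply ConcreteCategory.hom_ext
      intro x
      exact upperMap_comm f m x)
  map_id X := by
    ext m x
    rfl
  map_comp f g := by
    ext m x
    rfl
/-- The total chain complex of an `n`-fold simplicial abelian group. -/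
def simpLowerTot (n : ℕ) : MultiSimp n ⥤ ChainComplex AddCommGrpCat.{0} ℕ :=
  (Functor.whiskeringLeft _ _ _).obj
    (Functor.pi fun _ : Fin n => SemiSimplexCategory.toSimplexCategory.op) ⋙ lowerTot n

/-- The total cochain complex of a cosimplicial chain complex. -/
def simpUpperTot : (SimplexCategory ⥤ ChainComplex AddCommGrpCat.{0} ℕ) ⥤
    CochainComplex AddCommGrpCat.{0} ℤ :=
  (Functor.whiskeringLeft _ _ _).obj SemiSimplexCategory.toSimplexCategory ⋙ upperTot

/-- `𝓑(n)`, the component of arity `n` of the operad of natural operations. -/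
def Big (n : ℕ) : CochainComplex AddCommGrpCat.{0} ℤ :=
  simpUpperTot.obj (B n ⋙ simpLowerTot n)

/-- `𝓣(n)`. -/
def Tam (n : ℕ) : CochainComplex AddCommGrpCat.{0} ℤ :=
  simpUpperTot.obj (T n ⋙ simpLowerTot n)

/-- The inclusion of `𝓣(n)` into `𝓑(n)`. -/
def tamToBig (n : ℕ) : Tam n ⟶ Big n :=
  simpUpperTot.map (Functor.whiskerRight (incl n) (simpLowerTot n))

/-- The non-unital version of `𝓑(n)`. -/
def hatBig (n : ℕ) : CochainComplex AddCommGrpCat.{0} ℤ :=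
  upperTot.obj (hatB n ⋙ lowerTot n)

/-- The non-unital version of `𝓣(n)`. -/
def hatTam (n : ℕ) : CochainComplex AddCommGrpCat.{0} ℤ :=
  upperTot.obj (hatT n ⋙ lowerTot n)

/-- The inclusion of the non-unital version of `𝓣(n)` into that of `𝓑(n)`. -/
def hatTamToBig (n : ℕ) : hatTam n ⟶ hatBig n :=
  upperTot.map (Functor.whiskerRight (hatIncl n) (lowerTot n))

end

end NatOps

/-! The free `S`-object is a left Kan extension along `joyal.rightOp`, so its value at `⟨l - 1⟩` is
a colimit over a comma category. This colimit collapses to a copower for the following reason.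
Concatenating the ordered fibres of a map `g` in `IS` lists all points of its source, with the
endpoints first and last. This list is a permutation `σ`, and `g` after `σ` is monotone with the
inherited order on its fibres. Hence `g` is an automorphism of its source followed by a monotone map
of intervals, and the latter is dual to a map in `Δ` (`ISHom.exists_factorization`,
`exists_eq_map'`). In the opposite category every arrow of the comma category therefore maps to one
given by an automorphism. So a functor `Y` on `ISᵒᵖ` with a map `X ⟶ j ⋙ Y` is the Kan extension of
`X` as soon as each `Y⟨l - 1⟩` is the copower of `X[l]` indexed by the automorphisms
(`isLeftKanExtension_of_isColimit_cofan`).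

For trees the copower condition is combinatorial. An automorphism permutes the labels of the legs
and changes nothing else. Reading the labels in the planar order gives a permutation of `0, …, l -
1`, so each labelled tree arises from exactly one planar tree by exactly one automorphism
(`bijective_relabel`). Since all groups are free on sets of trees, this bijection of bases gives the
bijectivity of `orbitMap`.

The chain totalization preserves these copowers, because in each degree it involves only finitely
many multidegrees, and so the same criterion applies to the total complexes. The cochain
totalization contains infinite products, but no colimit has to be moved past it: it is only applied
to isomorphisms already constructed. In the non-unital case the same argument works, because the
monotone factor of a surjection is a surjection and is dual to an injective map. -/

namespace NatOps

/-! ### A criterion for left Kan extensions by copowers -/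

section Kan

open Limits

universe w v u₁ u₂ u₃ v₁ v₂

/-- If every morphism `L.obj d ⟶ L.obj d'` is the image of a morphism of `D` followed by one of the
endomorphisms `a d' h`, then a functor that is on objects a copower of `X` indexed by these
endomorphisms is a left Kan extension. -/
theorem isLeftKanExtension_of_isColimit_cofan {D : Type u₁} [Category.{v₁} D] {J : Type u₂}
    [Category.{v₂} J] {C : Type u₃} [Category.{v} C] (L : D ⥤ J) {X : D ⥤ C} {Y : J ⥤ C}
    (α : X ⟶ L ⋙ Y) (hobj : ∀ y : J, ∃ d, L.obj d = y) {H : D → Type w}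
    (a : ∀ d, H d → (L.obj d ⟶ L.obj d))
    (hfac : ∀ {d d' : D} (f : L.obj d ⟶ L.obj d'), ∃ φ h, f = L.map φ ≫ a d' h)
    (hcol : ∀ d, Nonempty (IsColimit
      (Cofan.mk (Y.obj (L.obj d)) fun h : H d => α.app d ≫ Y.map (a d h)))) :
    Y.IsLeftKanExtension α := by
  refine Functor.LeftExtension.IsPointwiseLeftKanExtension.isLeftKanExtension
    (E := Functor.LeftExtension.mk Y α) fun y => Nonempty.some ?_
  obtain ⟨d, rfl⟩ := hobj y
  obtain ⟨hd⟩ := hcol d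
  -- Each object of the comma category over `L.obj d` maps to one of the objects `a d h`, so a
  -- cocone `s` is determined by its components there, and the copower supplies a map with these
  -- components.
  refine ⟨⟨fun s => Cofan.IsColimit.desc hd
      fun h => s.ι.app (CostructuredArrow.mk (Y := d) (a d h)),
    fun s g => ?_, fun s m hm => ?_⟩⟩
  -- The factorization turns `φ` into a morphism of the comma category from `g` to `a d h`. No
  -- uniqueness of the factorization is needed, since compatibility of the cocone makes every choice
  -- give the same component.
  · obtain ⟨φ, h, hg⟩ := hfac g.hom
    have hs := s.w (CostructuredArrow.homMk φ hg.symm :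
      g ⟶ CostructuredArrow.mk (Y := d) (a d h))
    have hα := α.naturality φ
    refine Eq.trans ?_ hs
    change (α.app g.left ≫ Y.map g.hom) ≫ _ = _
    have hf : (α.app d ≫ Y.map (a d h)) ≫ Cofan.IsColimit.desc hd
          (fun h => s.ι.app (CostructuredArrow.mk (Y := d) (a d h))) =
        s.ι.app (CostructuredArrow.mk (Y := d) (a d h)) := Cofan.IsColimit.fac hd _ h
    have hg' : α.app g.left ≫ Y.map g.hom = X.map φ ≫ α.app d ≫ Y.map (a d h) := by
      rw [hg, Y.map_comp]
      exact (Category.assoc _ _ _).symm.trans ((congrArg (· ≫ Y.map (a d h)) hα.symm).trans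
        (Category.assoc _ _ _))
    exact (congrArg (· ≫ Cofan.IsColimit.desc hd _) hg').trans
      ((Category.assoc _ _ _).trans (congrArg (X.map φ ≫ ·) hf))
  · refine Cofan.IsColimit.hom_ext hd _ _ fun h => ?_
    exact (hm (CostructuredArrow.mk (Y := d) (a d h))).trans
      (Cofan.IsColimit.fac hd (fun h => s.ι.app (CostructuredArrow.mk (Y := d) (a d h))) h).symm

/-- A functor with the universal property of the left Kan extension is isomorphic to it,
compatibly with the units. -/
theorem exists_lan_iso {D : Type u₁} [Category.{v₁} D] {J : Type u₂}
    [Category.{v₂} J] {C : Type u₃} [Category.{v} C] (L : D ⥤ J)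
    [∀ F : D ⥤ C, L.HasLeftKanExtension F] {X : D ⥤ C} {Y : J ⥤ C}
    (α : X ⟶ L ⋙ Y) [Y.IsLeftKanExtension α] :
    ∃ e : L.lan.obj X ≅ Y,
      (L.lanAdjunction C).unit.app X ≫ Functor.whiskerLeft L e.hom = α := by
  refine ⟨Functor.leftKanExtensionUnique _ (L.lanUnit.app X) _ α, ?_⟩
  rw [Functor.lanAdjunction_unit]
  ext d
  simp [Functor.leftKanExtensionUnique]

/-- A family of maps of abelian groups is a copower cofan if the induced map from the group of
finitely supported functions is bijective. -/
theorem isColimit_cofan_of_bijective {H : Type} {A B : AddCommGrpCat.{0}} (f : H → (A ⟶ B))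
    (hf : Function.Bijective (Finsupp.liftAddHom fun h => (f h).hom : (H →₀ A) →+ B)) :
    Nonempty (IsColimit (Cofan.mk B f)) := by
  classical
  let e : (H →₀ A) ≃+ B := AddEquiv.ofBijective _ hf
  have he : ∀ h x, e (Finsupp.single h x) = (f h).hom x := fun h x => by
    simp [e]
  refine ⟨Cofan.IsColimit.mk _ (fun s => AddCommGrpCat.ofHom
      ((Finsupp.liftAddHom fun h => (s.inj h).hom).comp e.symm.toAddMonoidHom))
    (fun s h => ?_) (fun s m hm => ?_)⟩
  · ext x
    change Finsupp.liftAddHom _ (e.symm ((f h).hom x)) = _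
    rw [← he, e.symm_apply_apply]
    simp
  · ext b
    obtain ⟨b, rfl⟩ := e.surjective b
    change m.hom (e b) = Finsupp.liftAddHom _ (e.symm (e b))
    rw [e.symm_apply_apply]
    refine DFunLike.congr_fun (f := m.hom.comp e.toAddMonoidHom) ?_ b
    ext h x
    simpa [he] using ConcreteCategory.congr_hom (hm h) x

/-- Copower cofans of functors are detected objectwise. -/
theorem isColimit_cofan_functor {E : Type u₁} [Category.{v₁} E] {C : Type u₃} [Category.{v} C]
    {H : Type w} {A B : E ⥤ C} (f : H → (A ⟶ B))
    (hf : ∀ e, Nonempty (IsColimit (Cofan.mk (B.obj e) fun h => (f h).app e))) :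
    Nonempty (IsColimit (Cofan.mk B f)) :=
  ⟨evaluationJointlyReflectsColimits _ fun e =>
    (isColimitMapCoconeCofanMkEquiv _ _ _).symm (hf e).some⟩

/-- Copower cofans of complexes are detected degreewise. -/
theorem isColimit_cofan_complex {H : Type w} {ι : Type*} {c : ComplexShape ι} {C : Type u₃}
    [Category.{v} C] [HasZeroMorphisms C] {A B : HomologicalComplex C c} (f : H → (A ⟶ B))
    (hf : ∀ i, Nonempty (IsColimit (Cofan.mk (B.X i) fun h => (f h).f i))) :
    Nonempty (IsColimit (Cofan.mk B f)) :=
  ⟨HomologicalComplex.isColimitOfEval _ _ fun i =>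
    (isColimitMapCoconeCofanMkEquiv (HomologicalComplex.eval C c i) _ _).symm (hf i).some⟩

end Kan

/-! ### Copowers of abelian groups: finite products and free groups -/

section Algebra

/-- Copowers commute with finite products. -/
theorem bijective_liftAddHom_pi {H K : Type} [Finite K] {A B : K → Type}
    [∀ k, AddCommGroup (A k)] [∀ k, AddCommGroup (B k)] (f : H → ∀ k, A k →+ B k)
    (hf : ∀ k, Function.Bijective (Finsupp.liftAddHom fun h => f h k)) :
    Function.Bijective (Finsupp.liftAddHom fun h => AddMonoidHom.pi
      fun k => (f h k).comp (Pi.evalAddMonoidHom A k)) := by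
  classical
  have := Fintype.ofFinite K
  -- The component `k` of the image depends only on the component `k` of `x`; both sides are
  -- additive in `x` and agree on singletons.
  have key : ∀ (x : H →₀ ∀ k, A k) k,
      Finsupp.liftAddHom (fun h => AddMonoidHom.pi
        fun k => (f h k).comp (Pi.evalAddMonoidHom A k)) x k =
      Finsupp.liftAddHom (fun h => f h k)
        (Finsupp.mapRange.addMonoidHom (Pi.evalAddMonoidHom A k) x) := by
    intro x k
    refine DFunLike.congr_fun (f := (Pi.evalAddMonoidHom B k).comp (Finsupp.liftAddHom
      (fun h => AddMonoidHom.pi fun k => (f h k).comp (Pi.evalAddMonoidHom A k))))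
      (g := (Finsupp.liftAddHom fun h => f h k).comp
        (Finsupp.mapRange.addMonoidHom (Pi.evalAddMonoidHom A k))) ?_ x
    ext h a
    simp
  constructor
  · rw [injective_iff_map_eq_zero]
    intro x hx
    ext h k
    have h0 := congrFun hx k
    rw [key] at h0
    have := (injective_iff_map_eq_zero _).1 (hf k).1 _ h0
    simpa using DFunLike.congr_fun this h
  · intro b
    choose y hy using fun k => (hf k).2 (b k)
    -- Preimages are chosen for each component separately and added up. This is where `K` has to be
    -- finite: otherwise the union of their supports could be infinite.
    refine ⟨∑ k, Finsupp.mapRange.addMonoidHom (AddMonoidHom.single A k) (y k), ?_⟩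
    funext k
    rw [key, ← hy k]
    congr 1
    rw [map_sum]
    ext h
    rw [Finsupp.finsetSum_apply, Finset.sum_eq_single k]
    · simp
    · intro k' _ hk
      simp [Pi.single_eq_of_ne hk.symm]
    · simp

/-- If `H × P → Q` is bijective, so is the induced map from the copower of `ℤ[P]` to `ℤ[Q]`. -/
theorem bijective_liftAddHom_free {H P Q : Type} (f : H → P → Q)
    (hf : Function.Bijective fun x : H × P => f x.1 x.2) :
    Function.Bijective (Finsupp.liftAddHom fun h => FreeAbelianGroup.map (f h)) := by
  classical
  let e : H × P ≃ Q := Equiv.ofBijective _ hf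
  -- The inverse places each generator `q` in the summand that the bijection `H × P ≃ Q` assigns to
  -- it.
  let g : FreeAbelianGroup Q →+ (H →₀ FreeAbelianGroup P) :=
    FreeAbelianGroup.lift fun q => Finsupp.single (e.symm q).1 (.of (e.symm q).2)
  have h1 : (Finsupp.liftAddHom fun h => FreeAbelianGroup.map (f h)).comp g =
      AddMonoidHom.id _ := by
    ext q
    simp only [g, AddMonoidHom.comp_apply, FreeAbelianGroup.lift_apply_of,
      Finsupp.liftAddHom_apply_single, FreeAbelianGroup.map_of_apply, AddMonoidHom.id_apply]
    exact congrArg _ (e.apply_symm_apply q)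
  have h2 : g.comp (Finsupp.liftAddHom fun h => FreeAbelianGroup.map (f h)) =
      AddMonoidHom.id _ := by
    ext h p : 2
    simp only [g, AddMonoidHom.comp_apply, FreeAbelianGroup.lift_apply_of,
      Finsupp.liftAddHom_apply_single, FreeAbelianGroup.map_of_apply, AddMonoidHom.id_apply,
      Finsupp.singleAddHom_apply]
    have := e.symm_apply_apply (h, p)
    rw [show f h p = e (h, p) from rfl, this]
  exact Function.bijective_iff_has_inverse.2
    ⟨g, fun x => DFunLike.congr_fun h2 x, fun x => DFunLike.congr_fun h1 x⟩

end Algebra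

/-- Totalization preserves copower cofans. -/
theorem isColimit_cofan_lowerTot {n : ℕ} {H : Type} {A B : MultiSemiSimp n} (f : H → (A ⟶ B))
    (hf : ∀ k, Function.Bijective (Finsupp.liftAddHom fun h => ((f h).app k).hom)) :
    Nonempty (Limits.IsColimit
      (Limits.Cofan.mk ((lowerTot n).obj B) fun h => (lowerTot n).map (f h))) := by
  refine isColimit_cofan_complex _ fun m => isColimit_cofan_of_bijective _ ?_
  -- The entries of a multidegree of total `m` are at most `m`, which leaves finitely many. Hence
  -- the product defining `LowerX` is also a direct sum and commutes with copowers.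
  have : Finite {k : Fin n → ℕ // ∑ a, k a = m} := by
    refine Finite.of_injective
      (fun k a => (⟨k.1 a, Nat.lt_succ_of_le ((Finset.single_le_sum
        (fun _ _ => Nat.zero_le _) (Finset.mem_univ a)).trans k.2.le)⟩ : Fin (m + 1))) ?_
    intro k k' h
    ext a
    exact congrArg Fin.val (congrFun h a)
  exact bijective_liftAddHom_pi
    (fun h (k : {k : Fin n → ℕ // ∑ a, k a = m}) => ((f h).app (lowerObj k.1)).hom)
    fun k => hf _

end NatOps

namespace NatOps

/-! ### Automorphisms of intervals as permutations fixing the endpoints -/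

namespace ISHom

theorem symm_fixes_endpoints {m : ℕ} (σ : Equiv.Perm (Fin (m + 2))) (h0 : σ 0 = 0)
    (hl : σ (Fin.last _) = Fin.last _) : σ.symm 0 = 0 ∧ σ.symm (Fin.last _) = Fin.last _ :=
  ⟨(Equiv.symm_apply_eq σ).2 h0.symm, (Equiv.symm_apply_eq σ).2 hl.symm⟩

/-- The automorphism whose fibre over `j` is `σ j`. -/
def ofPerm {m : ℕ} (σ : Equiv.Perm (Fin (m + 2))) (h0 : σ 0 = 0)
    (hl : σ (Fin.last _) = Fin.last _) : ISHom m m where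
  toFun := σ.symm
  fib j := [σ j]
  mem_fib j x := by rw [List.mem_singleton, Equiv.symm_apply_eq]
  nodup := by simp
  head_fib := by simp [h0]
  last_fib := by simp [hl]

theorem ofPerm_comp_symm {m : ℕ} (σ : Equiv.Perm (Fin (m + 2))) (h0 hl h0' hl') :
    (ofPerm σ h0 hl).comp (ofPerm σ.symm h0' hl') = ISHom.id m :=
  ext_fib (by funext j; simp [ofPerm, comp, ISHom.id])

theorem ofPerm_symm_comp {m : ℕ} (σ : Equiv.Perm (Fin (m + 2))) (h0 hl h0' hl') :
    (ofPerm σ.symm h0' hl').comp (ofPerm σ h0 hl) = ISHom.id m :=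
  ext_fib (by funext j; simp [ofPerm, comp, ISHom.id])

/-- An injective self-map of a finite set is bijective, so its fibres are singletons and the orders
on them carry no information. As `ofPerm` records the element of each fibre, `σ` is the inverse of
the underlying map. -/
theorem exists_eq_ofPerm {m : ℕ} (h : ISHom m m) (hh : Function.Injective h.toFun) :
    ∃ σ h0 hl, h = ofPerm σ h0 hl := by
  let e : Equiv.Perm (Fin (m + 2)) := Equiv.ofBijective _ (Finite.injective_iff_bijective.1 hh)
  obtain ⟨h0, hl⟩ := symm_fixes_endpoints e h.toFun_zero h.toFun_last
  refine ⟨e.symm, h0, hl, ext_fib (funext fun j => ?_)⟩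
  refine List.perm_singleton.1 ((List.perm_ext_iff_of_nodup (h.nodup j)
    (List.nodup_singleton _)).2 fun x => ?_)
  rw [h.mem_fib, List.mem_singleton, Equiv.eq_symm_apply]
  rfl

/-- The interior of a permutation that fixes the endpoints. -/
theorem exists_interior_perm {m : ℕ} (σ : Equiv.Perm (Fin (m + 2))) (h0 : σ 0 = 0)
    (hl : σ (Fin.last _) = Fin.last _) :
    ∃ ρ : Fin m → Fin m, ∀ i, σ i.castSucc.succ = (ρ i).castSucc.succ := by
  suffices ∀ i : Fin m, ∃ i' : Fin m, σ i.castSucc.succ = i'.castSucc.succ by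
    choose ρ hρ using this
    exact ⟨ρ, hρ⟩
  intro i
  rcases fin_cases3 (σ i.castSucc.succ) with h | h | h
  · exact absurd (σ.injective (h.trans h0.symm)) (Fin.succ_ne_zero _)
  · have := σ.injective (h.trans hl.symm)
    rw [← Fin.succ_last] at this
    exact absurd (Fin.succ_injective _ this) (Fin.castSucc_lt_last i).ne
  · exact h

/-- Extension of a self-map of the interior by the identity on the endpoints. -/
def extend {m : ℕ} (f : Fin m → Fin m) : Fin (m + 2) → Fin (m + 2) :=
  Fin.cons 0 (Fin.snoc (fun i => (f i).castSucc.succ) (Fin.last _) : Fin (m + 1) → Fin (m + 2))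

theorem extend_zero {m : ℕ} (f : Fin m → Fin m) : extend f 0 = 0 := rfl

theorem extend_last {m : ℕ} (f : Fin m → Fin m) : extend f (Fin.last _) = Fin.last _ := by
  rw [extend, ← Fin.succ_last, Fin.cons_succ, Fin.snoc_last]

theorem extend_mid {m : ℕ} (f : Fin m → Fin m) (i : Fin m) :
    extend f i.castSucc.succ = (f i).castSucc.succ := by
  rw [extend, Fin.cons_succ, Fin.snoc_castSucc]

theorem extend_leftInverse {m : ℕ} {f g : Fin m → Fin m} (h : Function.LeftInverse f g) :
    Function.LeftInverse (extend f) (extend g) := by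
  intro x
  rcases fin_cases3 x with rfl | rfl | ⟨i, rfl⟩
  · rw [extend_zero, extend_zero]
  · rw [extend_last, extend_last]
  · rw [extend_mid, extend_mid, h]

theorem exists_extend_perm {m : ℕ} (ρ : Equiv.Perm (Fin m)) :
    ∃ σ : Equiv.Perm (Fin (m + 2)), σ 0 = 0 ∧ σ (Fin.last _) = Fin.last _ ∧
      ∀ i, σ i.castSucc.succ = (ρ i).castSucc.succ :=
  ⟨⟨extend ρ, extend ρ.symm, extend_leftInverse ρ.left_inv, extend_leftInverse ρ.right_inv⟩,
    extend_zero ρ, extend_last ρ, extend_mid ρ⟩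

end ISHom

/-! ### Automorphisms act by relabelling the legs -/

section Relabel

variable {n : ℕ} {k : Fin n → ℕ}

theorem Word.legs_mul {α : Type} (u w : Word k α) : (u * w).legs = u.legs ++ w.legs := by
  induction u with
  | nil => rfl
  | leg a u ih => rw [leg_mul, legs, legs, ih, List.cons_append]
  | white i c u _ ih => rw [white_mul, legs, legs, ih, List.append_assoc]

/-- Evaluation with `vertex` rebuilds the tree as it was, and each leg is replaced by a single leg,
so the planar order is kept. -/
theorem Word.legs_relabel {α β : Type} (f : α → β) (w : Word k α) :
    (w.eval Word.vertex fun a => Word.var (f a)).legs = w.legs.map f := by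
  induction w with
  | nil => rfl
  | leg a w ih => rw [eval, legs_mul, ih]; rfl
  | white i c w ih1 ih =>
    rw [eval, legs_mul, ih, vertex, legs, legs]
    simp only [ih1, legs, List.append_nil, List.map_append, List.map_flatten, List.map_ofFn,
      Function.comp_def]

/-- The fibres over the endpoints contain only endpoints, so the two outer factors of `opO` are
trivial. Every other fibre contributes exactly one variable, and the identities in the lower indices
leave the white vertices alone. -/
theorem act_ofPerm {l : ℕ} (σ : Equiv.Perm (Fin (l + 2))) (h0 : σ 0 = 0)
    (hl : σ (Fin.last _) = Fin.last _) {ρ : Fin l → Fin l}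
    (hρ : ∀ i, σ i.castSucc.succ = (ρ i).castSucc.succ) (w : Word k (Fin l)) :
    act (ISHom.ofPerm σ h0 hl) (fun i => ISHom.id (k i)) w =
      w.eval Word.vertex fun i => Word.var (ρ i) := by
  have hb : ∀ j, bar (ISHom.ofPerm σ h0 hl) (Word.var (k := k)) j = ext Word.var (σ j) := by
    intro j
    simp [bar, ISHom.ofPerm]
  have e : (fun i => opO (ISHom.id (k i)) (Word.vertex (k := k) (α := Fin l) i)) =
      fun i => Word.vertex i := by
    funext i c
    exact opO_id _ _
  rw [act, e, opO, hb, hb, h0, hl, ext_zero, ext_last, one_mul, mul_one]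
  simp only [hb, hρ, ext_mid]

theorem legs_act_ofPerm {l : ℕ} (σ : Equiv.Perm (Fin (l + 2))) (h0 : σ 0 = 0)
    (hl : σ (Fin.last _) = Fin.last _) {ρ : Fin l → Fin l}
    (hρ : ∀ i, σ i.castSucc.succ = (ρ i).castSucc.succ) (w : Word k (Fin l)) :
    (act (ISHom.ofPerm σ h0 hl) (fun i => ISHom.id (k i)) w).legs = w.legs.map ρ := by
  rw [act_ofPerm σ h0 hl hρ, Word.legs_relabel]

/-- For a planar tree the labels read `0, …, l - 1`. After the action they read `ρ 0, …, ρ (l - 1)`,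
so the permutation can be recovered from the resulting tree alone. -/
theorem ofPerm_injective_of_isPlanar {l : ℕ} {w w' : Word k (Fin l)} (hw : IsPlanar w)
    (hw' : IsPlanar w') {σ τ : Equiv.Perm (Fin (l + 2))} {h0 hl h0' hl'}
    (h : act (ISHom.ofPerm σ h0 hl) (fun i => ISHom.id (k i)) w =
      act (ISHom.ofPerm τ h0' hl') (fun i => ISHom.id (k i)) w') : σ = τ := by
  obtain ⟨ρ, hρ⟩ := ISHom.exists_interior_perm σ h0 hl
  obtain ⟨ρ', hρ'⟩ := ISHom.exists_interior_perm τ h0' hl'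
  have := congrArg Word.legs h
  rw [legs_act_ofPerm σ h0 hl hρ, legs_act_ofPerm τ h0' hl' hρ', hw, hw'] at this
  ext1 x
  rcases fin_cases3 x with rfl | rfl | ⟨i, rfl⟩
  · rw [h0, h0']
  · rw [hl, hl']
  · rw [hρ, hρ', List.map_inj_left.1 this i (List.mem_finRange i)]

theorem act_comp_id {l l' l'' : ℕ} (g : ISHom l' l) (g' : ISHom l'' l') (w : Word k (Fin l)) :
    act g' (fun i => ISHom.id (k i)) (act g (fun i => ISHom.id (k i)) w) =
      act (g'.comp g) (fun i => ISHom.id (k i)) w := by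
  rw [← act_comp]
  rfl

/-- The labels of the legs form a list of length `l` without repetition, that is, a permutation, and
the inverse permutation sorts it. The witness is written as `σ.symm` so that acting with `σ`
afterwards gives back `w`. -/
theorem exists_isPlanar_act {l : ℕ} {w : Word k (Fin l)} (hw : IsTree w) :
    ∃ (σ : Equiv.Perm (Fin (l + 2))) (h0 : σ.symm 0 = 0) (hl : σ.symm (Fin.last _) = Fin.last _),
      IsPlanar (act (ISHom.ofPerm σ.symm h0 hl) (fun i => ISHom.id (k i)) w) := by
  have hnd : w.legs.Nodup := hw.legs.nodup_iff.2 (List.nodup_finRange l)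
  have hlen : w.legs.length = l := hw.legs.length_eq.trans (List.length_finRange)
  have hinj : Function.Injective fun i : Fin l => w.legs.get (i.cast hlen.symm) := by
    intro i j h
    exact Fin.cast_injective _ (List.nodup_iff_injective_get.1 hnd h)
  let ρ : Equiv.Perm (Fin l) := Equiv.ofBijective _ (Finite.injective_iff_bijective.1 hinj)
  have hρ : w.legs = (List.finRange l).map ρ := by
    refine List.ext_get (by simp [hlen]) fun i h1 h2 => ?_
    simp [ρ]
  obtain ⟨σ, h0, hl, hσ⟩ := ISHom.exists_extend_perm ρ
  obtain ⟨h0', hl'⟩ := ISHom.symm_fixes_endpoints σ h0 hl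
  refine ⟨σ, h0', hl', ?_⟩
  rw [IsPlanar, legs_act_ofPerm σ.symm h0' hl' (ρ := ρ.symm), hρ, List.map_map]
  · simp
  · intro i
    rw [Equiv.symm_apply_eq, hσ, Equiv.apply_symm_apply]

end Relabel

/-! ### Factorization of interval maps and Joyal duality -/

section Factorization

theorem mem_flatMap_fib {m p : ℕ} (g : ISHom m p) (x) :
    x ∈ (List.finRange (p + 2)).flatMap g.fib :=
  List.mem_flatMap.2 ⟨_, List.mem_finRange _, (g.mem_fib _ _).2 rfl⟩

theorem nodup_flatMap_fib {m p : ℕ} (g : ISHom m p) {L : List (Fin (p + 2))} (hL : L.Nodup) :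
    (L.flatMap g.fib).Nodup := by
  rw [List.nodup_flatMap]
  refine ⟨fun j _ => g.nodup j, hL.imp fun {i j} hij x hi hj => ?_⟩
  rw [g.mem_fib] at hi hj
  exact hij (hi.symm.trans hj)

/-- The fibres are disjoint and `j` occurs once in `L`, so the elements over `j` form one contiguous
block of the concatenation. Thus the concatenated list together with `g.toFun` still knows the order
on each fibre. -/
theorem filter_flatMap_fib {m p : ℕ} (g : ISHom m p) (j) {L : List (Fin (p + 2))} (hL : L.Nodup)
    (hj : j ∈ L) : (L.flatMap g.fib).filter (fun x => g.toFun x = j) = g.fib j := by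
  induction L with
  | nil => simp at hj
  | cons a L ih =>
    rw [List.nodup_cons] at hL
    rw [List.flatMap_cons, List.filter_append]
    by_cases h : a = j
    · subst h
      rw [List.filter_eq_self.2, List.filter_eq_nil_iff.2, List.append_nil]
      · intro x hx
        obtain ⟨b, hb, hx⟩ := List.mem_flatMap.1 hx
        rw [g.mem_fib] at hx
        simp only [decide_eq_true_eq]
        rintro rfl
        exact hL.1 (hx ▸ hb)
      · intro x hx
        simpa using (g.mem_fib _ _).1 hx
    · rw [ih hL.2 ((List.mem_cons.1 hj).resolve_left (Ne.symm h)), List.filter_eq_nil_iff.2,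
        List.nil_append]
      intro x hx
      rw [g.mem_fib] at hx
      simpa [hx] using h

/-- Every map of intervals with ordered fibres is an automorphism followed by a monotone map. -/
theorem ISHom.exists_factorization {m p : ℕ} (g : ISHom m p) :
    ∃ σ h0 hl f h0' hl', Monotone f ∧ g = (ofPerm σ h0 hl).comp (ofMono f h0' hl') := by
  -- `L` lists the points of the source by increasing value under `g`, and within a fibre by the
  -- order of that fibre. The permutation `σ` sends a position to the point listed there.
  set L := (List.finRange (p + 2)).flatMap g.fib with hL
  have hnd : L.Nodup := nodup_flatMap_fib g (List.nodup_finRange _)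
  have hperm : L.Perm (List.finRange (m + 2)) :=
    (List.perm_ext_iff_of_nodup hnd (List.nodup_finRange _)).2
      fun x => ⟨fun _ => List.mem_finRange x, fun _ => mem_flatMap_fib g x⟩
  have hlen : L.length = m + 2 := hperm.length_eq.trans List.length_finRange
  let σ : Equiv.Perm (Fin (m + 2)) := Equiv.ofBijective (fun i => L.get (i.cast hlen.symm))
    (Finite.injective_iff_bijective.1 fun i j h =>
      Fin.cast_injective _ (List.nodup_iff_injective_get.1 hnd h))
  have hσ : (List.finRange (m + 2)).map σ = L := by
    refine List.ext_get (by simp [hlen]) fun i h1 h2 => ?_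
    simp [σ]
  -- The left endpoint heads the first fibre and hence all of `L`; dually, the right endpoint closes
  -- the last fibre.
  have h0 : σ 0 = 0 := by
    have h : L.head? = some 0 := by
      rw [hL, List.finRange_succ, List.flatMap_cons, List.head?_append, g.head_fib]
      rfl
    rw [← hσ, List.finRange_succ] at h
    simpa using h
  have hl : σ (Fin.last _) = Fin.last _ := by
    have h : L.getLast? = some (Fin.last _) := by
      rw [hL, List.finRange_succ_last, List.flatMap_append, List.getLast?_append]
      simp [g.last_fib]
    rw [← hσ, List.finRange_succ_last] at h
    simpa using h
  have hmono : Monotone fun x => g.toFun (σ x) := by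
    have h1 : (L.map g.toFun).Pairwise (· ≤ ·) := by
      rw [hL, List.map_flatMap, List.pairwise_flatMap]
      refine ⟨fun j _ => ?_, (List.pairwise_lt_finRange _).imp fun {a b} hab x hx y hy => ?_⟩
      · refine List.pairwise_of_forall_mem_list fun x hx y hy => ?_
        obtain ⟨x, hx', rfl⟩ := List.mem_map.1 hx
        obtain ⟨y, hy', rfl⟩ := List.mem_map.1 hy
        rw [(g.mem_fib _ _).1 hx', (g.mem_fib _ _).1 hy']
      · obtain ⟨x, hx', rfl⟩ := List.mem_map.1 hx
        obtain ⟨y, hy', rfl⟩ := List.mem_map.1 hy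
        rw [(g.mem_fib _ _).1 hx', (g.mem_fib _ _).1 hy']
        exact hab.le
    rw [← hσ, List.map_map, ← List.ofFn_eq_map, List.pairwise_ofFn] at h1
    intro x y hxy
    rcases hxy.eq_or_lt with rfl | hxy
    · exact le_rfl
    · exact h1 hxy
  refine ⟨σ, h0, hl, fun x => g.toFun (σ x), (congrArg _ h0).trans g.toFun_zero,
    (congrArg _ hl).trans g.toFun_last, hmono, ext_fib (funext fun j => ?_)⟩
  -- The fibre of the composite over `j` is obtained by selecting the positions with value `j` and
  -- applying `σ`. This is the same as selecting the points over `j` in `L`, which recovers `g.fib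
  -- j` with its order.
  rw [← filter_flatMap_fib g j (List.nodup_finRange _) (List.mem_finRange j), ← hL, ← hσ,
    List.filter_map]
  exact List.map_eq_flatMap

/-- Monotone maps of intervals are dual to monotone maps. -/
theorem exists_eq_map' {m p : ℕ} (f : Fin (m + 2) → Fin (p + 2)) (hf : Monotone f)
    (h0 : f 0 = 0) (hl : f (Fin.last _) = Fin.last _) :
    ∃ φ : Fin (p + 1) →o Fin (m + 1), f = SimplexCategory.II.map' φ := by
  have hne : ∀ y : Fin (p + 1),
      (Finset.univ.filter fun x : Fin (m + 1) => f x.castSucc ≤ y.castSucc).Nonempty :=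
    fun y => ⟨0, by simp [h0]⟩
  -- `φ y` is the largest `x` other than the right endpoint with `f x ≤ y`. The left endpoint always
  -- qualifies, because `f 0 = 0`.
  let φ : Fin (p + 1) →o Fin (m + 1) :=
    ⟨fun y => Finset.max' _ (hne y), fun y y' h => Finset.max'_subset _ fun x hx => by
      simp only [Finset.mem_filter, Finset.mem_univ, true_and] at hx ⊢
      exact hx.trans (Fin.castSucc_le_castSucc_iff.2 h)⟩
  -- This adjunction says that `f x` is the least `y` with `x ≤ φ y`, or the right endpoint if there
  -- is none, and that is how `map' φ` is characterized. For `x` the right endpoint both sides fail,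
  -- since `f` preserves it.
  have hφ : ∀ x y, x ≤ (φ y).castSucc ↔ f x ≤ y.castSucc := by
    intro x y
    have hmem : f (φ y).castSucc ≤ y.castSucc := by
      have := Finset.max'_mem _ (hne y)
      exact (Finset.mem_filter.1 this).2
    refine ⟨fun h => (hf h).trans hmem, fun h => ?_⟩
    obtain ⟨x, rfl⟩ | rfl := x.eq_castSucc_or_eq_last
    · exact Fin.castSucc_le_castSucc_iff.2 (Finset.le_max' _ _ (by simpa using h))
    · rw [hl] at h
      exact absurd h (not_le.2 (Fin.castSucc_lt_last y))
  refine ⟨φ, funext fun x => ?_⟩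
  obtain ⟨y, hy⟩ | hy := (f x).eq_castSucc_or_eq_last
  · rw [hy, eq_comm, SimplexCategory.II.map'_eq_castSucc_iff, hφ, hy]
    refine ⟨le_rfl, fun i hi => ?_⟩
    rw [← not_le, hφ, hy, not_le]
    exact Fin.castSucc_lt_castSucc_iff.2 hi
  · rw [hy, eq_comm, SimplexCategory.II.map'_eq_last_iff]
    intro i
    rw [← not_le, hφ, hy, not_le]
    exact Fin.castSucc_lt_last i

/-- If `y'` is the value at `x`, then it is the least index with `x ≤ φ y'`, so `φ y < x ≤ φ y'` for
every `y < y'`. Surjectivity provides such an `x` for each `y'`, and `φ` is strictly monotone. -/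
theorem injective_of_surjective_map' {m p : ℕ} (φ : Fin (p + 1) →o Fin (m + 1))
    (h : Function.Surjective (SimplexCategory.II.map' φ)) : Function.Injective φ := by
  refine (StrictMono.injective fun y y' hy => ?_)
  obtain ⟨x, hx⟩ := h y'.castSucc
  rw [SimplexCategory.II.map'_eq_castSucc_iff] at hx
  exact Fin.castSucc_lt_castSucc_iff.1 ((hx.2 y hy).trans_le hx.1)

end Factorization

end NatOps

namespace NatOps

/-! ### Factorization in the opposite categories of intervals -/

section Aut

theorem injective_toFun_of_iso {a b : IS} (h : a ≅ b) : Function.Injective (ISHom.toFun h.hom) :=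
  fun x y hxy => by
    have key : ∀ x, ISHom.toFun h.inv (ISHom.toFun h.hom x) = x := fun x =>
      congrFun (congrArg ISHom.toFun h.hom_inv_id) x
    rw [← key x, hxy, key]

/-- The automorphism of `⟨m - 1⟩` given by a permutation that fixes the endpoints. -/
def permAut {a : IS} (σ : Equiv.Perm (Fin (a.len + 2))) (h0 : σ 0 = 0)
    (hl : σ (Fin.last _) = Fin.last _) : Aut a where
  hom := ISHom.ofPerm σ h0 hl
  inv := ISHom.ofPerm σ.symm (ISHom.symm_fixes_endpoints σ h0 hl).1
    (ISHom.symm_fixes_endpoints σ h0 hl).2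
  hom_inv_id := ISHom.ofPerm_comp_symm _ _ _ _ _
  inv_hom_id := ISHom.ofPerm_symm_comp _ _ _ _ _

/-- The same in the category of surjective maps. -/
def permAutSurj {a : ISsurj} (σ : Equiv.Perm (Fin (a.obj.len + 2))) (h0 : σ 0 = 0)
    (hl : σ (Fin.last _) = Fin.last _) : Aut a :=
  WideSubcategory.isoMk (permAut σ h0 hl) σ.symm.surjective σ.surjective

end Aut

section Factorization

/-- The permutation acts on the source of `f.unop`, which is the target of `f`. Passing to the
opposite category therefore puts the map of `Δ` first and the automorphism last, as the criterion
for Kan extensions requires. -/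
theorem joyal_exists_factorization {d d' : SimplexCategory}
    (f : joyal.rightOp.obj d ⟶ joyal.rightOp.obj d') :
    ∃ (φ : d ⟶ d') (h : Aut (joyal.rightOp.obj d').unop),
      f = joyal.rightOp.map φ ≫ h.hom.op := by
  obtain ⟨σ, h0, hl, p, hp0, hpl, hp, hf⟩ := ISHom.exists_factorization f.unop
  obtain ⟨φ, rfl⟩ := exists_eq_map' p hp hp0 hpl
  exact ⟨SimplexCategory.Hom.mk φ, permAut σ h0 hl, Quiver.Hom.unop_inj hf⟩

theorem joyalInj_exists_factorization {d d' : SemiSimplexCategory}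
    (f : joyalInj.rightOp.obj d ⟶ joyalInj.rightOp.obj d') :
    ∃ (φ : d ⟶ d') (h : Aut (joyalInj.rightOp.obj d').unop),
      f = joyalInj.rightOp.map φ ≫ h.hom.op := by
  obtain ⟨σ, h0, hl, p, hp0, hpl, hp, hf⟩ := ISHom.exists_factorization f.unop.hom
  -- A composite can be surjective only if its last factor is, so the monotone part stays in the
  -- subcategory and its dual is injective.
  have hs : Function.Surjective p := by
    intro y
    obtain ⟨x, hx⟩ := f.unop.property y
    rw [hf] at hx
    exact ⟨_, hx⟩
  obtain ⟨φ, rfl⟩ := exists_eq_map' p hp hp0 hpl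
  refine ⟨SemiSimplexCategory.homEquiv.symm (OrderEmbedding.ofStrictMono φ
    (φ.monotone.strictMono_of_injective (injective_of_surjective_map' φ hs))),
    permAutSurj σ h0 hl, Quiver.Hom.unop_inj ?_⟩
  apply WideSubcategory.hom_ext
  exact hf

end Factorization

/-! ### Labelled trees as free orbits of planar trees -/

section Orbit

/-- In the curried functor a map of the upper index comes paired with `v.map (𝟙 k)`. Replacing this
by plain identities makes the relabelling lemmas applicable. -/
theorem treeFunctor_map_app_val {n : ℕ} {D E : Type} [Category.{0} D] [Category.{0} E]
    (u : D ⥤ ISᵒᵖ) (v : E ⥤ (Fin n → IS)) (P hP) {X Y : D} (g : X ⟶ Y) (k : E)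
    (w : ((treeFunctor u v P hP).obj X).obj k) :
    (((treeFunctor u v P hP).map g).app k w).1 =
      act (u.map g).unop (fun i => ISHom.id (v.obj k i).len) w.1 := by
  change act (u.map g).unop (v.map (𝟙 k)) w.1 = _
  rw [v.map_id]
  rfl

/-- All maps involved send basis elements to basis elements, so the question reduces to a bijection
between the sets of trees. -/
theorem bijective_orbitMap_linearize {D G E : Type} [Category.{0} D] [Category.{0} G]
    [Category.{0} E] {j : D ⥤ Gᵒᵖ} {X : D ⥤ E ⥤ Type} {Y : Gᵒᵖ ⥤ E ⥤ Type} (α : X ⟶ j ⋙ Y)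
    (d : D) (e : E)
    (h : Function.Bijective fun x : Aut (j.obj d).unop × (X.obj d).obj e =>
      (Y.map x.1.hom.op).app e ((α.app d).app e x.2)) :
    Function.Bijective (orbitMap (X := linearize X) (Y := linearize Y)
      (Functor.whiskerRight α _) d e) := by
  have e : orbitMap (X := linearize X) (Y := linearize Y) (Functor.whiskerRight α _) d e =
      Finsupp.liftAddHom fun h : Aut (j.obj d).unop =>
        FreeAbelianGroup.map fun x => (Y.map h.hom.op).app e ((α.app d).app e x) := by
    unfold orbitMap
    congr 1
    funext h
    ext x
    exact (FreeAbelianGroup.map_comp_apply x).symm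
  rw [e]
  exact bijective_liftAddHom_free _ h

/-- Every labelling of the legs of a tree is obtained from the planar one by exactly one
automorphism. -/
theorem bijective_relabel {n l : ℕ} {k : Fin n → ℕ} {H : Type} (g : H → ISHom l l)
    (hg : Function.Injective g) (hg' : ∀ h, Function.Injective (g h).toFun)
    (hσ : ∀ σ h0 hl, ∃ h, g h = ISHom.ofPerm σ h0 hl) {P : Word k (Fin l) → Prop}
    (hPt : ∀ w, P w → IsTree w) (hPg : ∀ h w, P w → P (act (g h) (fun i => ISHom.id (k i)) w))
    (F : H × {w // P w ∧ IsPlanar w} → {w // P w})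
    (hF : ∀ x, (F x).1 = act (g x.1) (fun i => ISHom.id (k i)) x.2.1) :
    Function.Bijective F := by
  constructor
  · rintro ⟨h, w, hw, hwp⟩ ⟨h', w', hw', hwp'⟩ hh
    replace hh := congrArg Subtype.val hh
    rw [hF, hF] at hh
    dsimp only at hh
    obtain ⟨σ, h0, hl, e⟩ := ISHom.exists_eq_ofPerm (g h) (hg' h)
    obtain ⟨σ', h0', hl', e'⟩ := ISHom.exists_eq_ofPerm (g h') (hg' h')
    rw [e, e'] at hh
    -- The leg labels of the common image determine the permutation. Acting with its inverse then
    -- recovers the planar tree.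
    obtain rfl := ofPerm_injective_of_isPlanar hwp hwp' hh
    obtain rfl := hg (e.trans e'.symm)
    obtain ⟨h1, hl1⟩ := ISHom.symm_fixes_endpoints σ h0 hl
    have := congrArg (act (ISHom.ofPerm σ.symm h1 hl1) (fun i => ISHom.id (k i))) hh
    rw [act_comp_id, act_comp_id, ISHom.ofPerm_symm_comp, act_id, act_id] at this
    subst this
    rfl
  · rintro ⟨w, hw⟩
    -- The preimage is the sorted tree together with the automorphism that undoes the sorting;
    -- stability of `P` under automorphisms keeps the sorted tree in the class.
    obtain ⟨σ, h0, hl, hp⟩ := exists_isPlanar_act (hPt w hw)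
    obtain ⟨h1, hl1⟩ := ISHom.symm_fixes_endpoints σ.symm h0 hl
    obtain ⟨h, hh⟩ := hσ σ h1 hl1
    obtain ⟨h', hh'⟩ := hσ σ.symm h0 hl
    refine ⟨(h, ⟨_, hh' ▸ hPg h' w hw, hp⟩), Subtype.ext ?_⟩
    rw [hF]
    dsimp only
    rw [hh, act_comp_id, ISHom.ofPerm_comp_symm, act_id]

theorem bijective_orbitMap_incl (n : ℕ) (l : SimplexCategory) (k : LowerIdx n) :
    Function.Bijective (orbitMap (Y := BS n) (incl n) l k) := by
  refine bijective_orbitMap_linearize (inclTrees n) l k ?_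
  exact bijective_relabel (n := n) (l := l.len) (k := fun i => (k i).unop.len) (P := IsTree)
    (fun h : Aut (joyal.rightOp.obj l).unop => (h.hom : ISHom l.len l.len))
    (fun h h' e => Iso.ext e) injective_toFun_of_iso
    (fun σ h0 hl => ⟨permAut (a := ⟨l.len⟩) σ h0 hl, rfl⟩) (fun _ hw => hw)
    (fun h w hw => hw.act _ _) _
    (fun x => treeFunctor_map_app_val (𝟭 ISᵒᵖ) (Functor.pi fun _ => joyal) _
      (fun _ _ _ hw => hw.act _ _) x.1.hom.op k _)

/-- Automorphisms are surjective, so relabelling creates no stubs, and the orbit argument restricts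
to the trees satisfying `IsHat`. -/
theorem bijective_orbitMap_hatIncl (n : ℕ) (l : SemiSimplexCategory) (k : LowerIdxInj n) :
    Function.Bijective (orbitMap (Y := hatBS n) (hatIncl n) l k) := by
  refine bijective_orbitMap_linearize (hatInclTrees n) l k ?_
  exact bijective_relabel (n := n) (l := l.len) (k := fun i => (k i).unop.len)
    (P := fun w => IsTree w ∧ IsHat w)
    (fun h : Aut (joyalInj.rightOp.obj l).unop => (h.hom.hom : ISHom l.len l.len))
    (fun h h' e => Iso.ext (WideSubcategory.hom_ext _ e))
    (fun h => injective_toFun_of_iso ((wideSubcategoryInclusion surj).mapIso h))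
    (fun σ h0 hl => ⟨permAutSurj (a := ⟨⟨l.len⟩⟩) σ h0 hl, rfl⟩) (fun _ hw => hw.1)
    (fun h w hw => ⟨hw.1.act _ _, hw.2.act _ h.hom.property _ fun i => Function.surjective_id⟩) _
    (fun x => treeFunctor_map_app_val (wideSubcategoryInclusion surj).op
      (Functor.pi fun _ => joyalInj ⋙ wideSubcategoryInclusion surj) _
      (fun g h _ hw => ⟨hw.1.act _ _, hw.2.act _ g.unop.property _
        fun i => (joyalInj.map (h i)).property⟩) x.1.hom.op k _)

end Orbit

end NatOps

namespace NatOps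

/-! ### Trees and their total complexes as Kan extensions -/

section Extension

variable {D G E : Type} [Category.{0} D] [Category.{0} G] [Category.{0} E] {j : D ⥤ Gᵒᵖ}
  {X : D ⥤ E ⥤ AddCommGrpCat.{0}} {Y : Gᵒᵖ ⥤ E ⥤ AddCommGrpCat.{0}} (α : X ⟶ j ⋙ Y)

/-- Colimits in `E ⥤ AddCommGrpCat` are computed objectwise, so the copower condition amounts to
bijectivity of `orbitMap` in each multidegree. -/
theorem isLeftKanExtension_of_bijective_orbitMap (hobj : ∀ y : Gᵒᵖ, ∃ d, j.obj d = y)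
    (hfac : ∀ {d d' : D} (f : j.obj d ⟶ j.obj d'),
      ∃ (φ : d ⟶ d') (h : Aut (j.obj d').unop), f = j.map φ ≫ h.hom.op)
    (hα : ∀ d e, Function.Bijective (orbitMap α d e)) : Y.IsLeftKanExtension α :=
  isLeftKanExtension_of_isColimit_cofan j α hobj (H := fun d => Aut (j.obj d).unop)
    (fun _ h => h.hom.op) hfac fun d =>
      isColimit_cofan_functor _ fun e => isColimit_cofan_of_bijective _ (hα d e)

/-- `F` need not preserve all colimits. It only has to preserve the copowers that occur in the
criterion, which is then applied afresh to `Y ⋙ F`. -/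
theorem isLeftKanExtension_whiskerRight {C : Type 1} [Category.{0} C]
    (F : (E ⥤ AddCommGrpCat.{0}) ⥤ C)
    (hF : ∀ {H : Type} {A B : E ⥤ AddCommGrpCat.{0}} (f : H → (A ⟶ B)),
      (∀ k, Function.Bijective (Finsupp.liftAddHom fun h => ((f h).app k).hom)) →
      Nonempty (Limits.IsColimit (Limits.Cofan.mk (F.obj B) fun h => F.map (f h))))
    (hobj : ∀ y : Gᵒᵖ, ∃ d, j.obj d = y)
    (hfac : ∀ {d d' : D} (f : j.obj d ⟶ j.obj d'),
      ∃ (φ : d ⟶ d') (h : Aut (j.obj d').unop), f = j.map φ ≫ h.hom.op)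
    (hα : ∀ d e, Function.Bijective (orbitMap α d e)) :
    (Y ⋙ F).IsLeftKanExtension (L := j) (Functor.whiskerRight α F) := by
  refine isLeftKanExtension_of_isColimit_cofan j _ hobj (H := fun d => Aut (j.obj d).unop)
    (fun _ h => h.hom.op) hfac fun d => ?_
  have := hF (fun h : Aut (j.obj d).unop => α.app d ≫ Y.map h.hom.op) (hα d)
  simp only [F.map_comp] at this
  exact this

end Extension

/-- `simpLowerTot` first forgets the degeneracies, and bijectivity in every multidegree survives
this restriction. -/
theorem isColimit_cofan_simpLowerTot {n : ℕ} {H : Type} {A B : MultiSimp n} (f : H → (A ⟶ B))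
    (hf : ∀ k, Function.Bijective (Finsupp.liftAddHom fun h => ((f h).app k).hom)) :
    Nonempty (Limits.IsColimit
      (Limits.Cofan.mk ((simpLowerTot n).obj B) fun h => (simpLowerTot n).map (f h))) :=
  isColimit_cofan_lowerTot (fun h => Functor.whiskerLeft
    (Functor.pi fun _ : Fin n => SemiSimplexCategory.toSimplexCategory.op) (f h)) fun _ => hf _

theorem joyal_obj_surjective (y : ISᵒᵖ) : ∃ d, joyal.rightOp.obj d = y :=
  ⟨SimplexCategory.mk y.unop.len, rfl⟩

theorem joyalInj_obj_surjective (y : ISsurjᵒᵖ) : ∃ d, joyalInj.rightOp.obj d = y :=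
  ⟨SemiSimplexCategory.mk y.unop.obj.len, rfl⟩

instance (n : ℕ) : (BS n).IsLeftKanExtension (incl n) :=
  isLeftKanExtension_of_bijective_orbitMap (incl n) joyal_obj_surjective
    joyal_exists_factorization (bijective_orbitMap_incl n)

instance (n : ℕ) : (BS n ⋙ simpLowerTot n).IsLeftKanExtension (L := joyal.rightOp)
    (Functor.whiskerRight (incl n) (simpLowerTot n)) :=
  isLeftKanExtension_whiskerRight (incl n) _ isColimit_cofan_simpLowerTot joyal_obj_surjective
    joyal_exists_factorization (bijective_orbitMap_incl n)

instance (n : ℕ) : (hatBS n).IsLeftKanExtension (hatIncl n) :=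
  isLeftKanExtension_of_bijective_orbitMap (hatIncl n) joyalInj_obj_surjective
    joyalInj_exists_factorization (bijective_orbitMap_hatIncl n)

instance (n : ℕ) : (hatBS n ⋙ lowerTot n).IsLeftKanExtension (L := joyalInj.rightOp)
    (Functor.whiskerRight (hatIncl n) (lowerTot n)) :=
  isLeftKanExtension_whiskerRight (hatIncl n) _ isColimit_cofan_lowerTot joyalInj_obj_surjective
    joyalInj_exists_factorization (bijective_orbitMap_hatIncl n)

end NatOps

/-! ### The comparison isomorphisms -/

theorem mainTheorem5 (n : ℕ) :
    -- the unital case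
    (∃ (e : (NatOps.freeS (NatOps.MultiSimp n)).obj (NatOps.T n) ≅ NatOps.BS n)
      (e' : (NatOps.freeS (ChainComplex AddCommGrpCat.{0} ℕ)).obj
          (NatOps.T n ⋙ NatOps.simpLowerTot n) ≅ NatOps.BS n ⋙ NatOps.simpLowerTot n)
      (E : NatOps.simpUpperTot.obj ((NatOps.monadS (NatOps.MultiSimp n)).obj (NatOps.T n) ⋙
          NatOps.simpLowerTot n) ≅ NatOps.Big n)
      (E' : NatOps.simpUpperTot.obj ((NatOps.monadS (ChainComplex AddCommGrpCat.{0} ℕ)).obj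
          (NatOps.T n ⋙ NatOps.simpLowerTot n)) ≅ NatOps.Big n),
      (NatOps.monadS (NatOps.MultiSimp n)).η.app (NatOps.T n) ≫
          Functor.whiskerLeft NatOps.joyal.rightOp e.hom = NatOps.incl n ∧
      (NatOps.monadS (ChainComplex AddCommGrpCat.{0} ℕ)).η.app
          (NatOps.T n ⋙ NatOps.simpLowerTot n) ≫
          Functor.whiskerLeft NatOps.joyal.rightOp e'.hom =
        Functor.whiskerRight (NatOps.incl n) (NatOps.simpLowerTot n) ∧
      E.hom = NatOps.simpUpperTot.map (Functor.whiskerRight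
          (Functor.whiskerLeft NatOps.joyal.rightOp e.hom) (NatOps.simpLowerTot n)) ∧
      E'.hom = NatOps.simpUpperTot.map (Functor.whiskerLeft NatOps.joyal.rightOp e'.hom) ∧
      NatOps.simpUpperTot.map (Functor.whiskerRight
          ((NatOps.monadS (NatOps.MultiSimp n)).η.app (NatOps.T n)) (NatOps.simpLowerTot n)) ≫
          E.hom = NatOps.tamToBig n ∧
      NatOps.simpUpperTot.map ((NatOps.monadS (ChainComplex AddCommGrpCat.{0} ℕ)).η.app
          (NatOps.T n ⋙ NatOps.simpLowerTot n)) ≫ E'.hom = NatOps.tamToBig n) ∧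
    (∀ (l : SimplexCategory) (k : NatOps.LowerIdx n),
      Function.Bijective (NatOps.orbitMap (Y := NatOps.BS n) (NatOps.incl n) l k)) ∧
    -- the non-unital case
    (∃ (e : (NatOps.hatFreeS (NatOps.MultiSemiSimp n)).obj (NatOps.hatT n) ≅ NatOps.hatBS n)
      (e' : (NatOps.hatFreeS (ChainComplex AddCommGrpCat.{0} ℕ)).obj
          (NatOps.hatT n ⋙ NatOps.lowerTot n) ≅ NatOps.hatBS n ⋙ NatOps.lowerTot n)
      (E : NatOps.upperTot.obj ((NatOps.hatMonadS (NatOps.MultiSemiSimp n)).obj (NatOps.hatT n) ⋙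
          NatOps.lowerTot n) ≅ NatOps.hatBig n)
      (E' : NatOps.upperTot.obj ((NatOps.hatMonadS (ChainComplex AddCommGrpCat.{0} ℕ)).obj
          (NatOps.hatT n ⋙ NatOps.lowerTot n)) ≅ NatOps.hatBig n),
      (NatOps.hatMonadS (NatOps.MultiSemiSimp n)).η.app (NatOps.hatT n) ≫
          Functor.whiskerLeft NatOps.joyalInj.rightOp e.hom = NatOps.hatIncl n ∧
      (NatOps.hatMonadS (ChainComplex AddCommGrpCat.{0} ℕ)).η.app
          (NatOps.hatT n ⋙ NatOps.lowerTot n) ≫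
          Functor.whiskerLeft NatOps.joyalInj.rightOp e'.hom =
        Functor.whiskerRight (NatOps.hatIncl n) (NatOps.lowerTot n) ∧
      E.hom = NatOps.upperTot.map (Functor.whiskerRight
          (Functor.whiskerLeft NatOps.joyalInj.rightOp e.hom) (NatOps.lowerTot n)) ∧
      E'.hom = NatOps.upperTot.map (Functor.whiskerLeft NatOps.joyalInj.rightOp e'.hom) ∧
      NatOps.upperTot.map (Functor.whiskerRight
          ((NatOps.hatMonadS (NatOps.MultiSemiSimp n)).η.app (NatOps.hatT n))
          (NatOps.lowerTot n)) ≫ E.hom = NatOps.hatTamToBig n ∧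
      NatOps.upperTot.map ((NatOps.hatMonadS (ChainComplex AddCommGrpCat.{0} ℕ)).η.app
          (NatOps.hatT n ⋙ NatOps.lowerTot n)) ≫ E'.hom = NatOps.hatTamToBig n) ∧
    (∀ (l : SemiSimplexCategory) (k : NatOps.LowerIdxInj n),
      Function.Bijective (NatOps.orbitMap (Y := NatOps.hatBS n) (NatOps.hatIncl n) l k)) := by
  refine ⟨?_, NatOps.bijective_orbitMap_incl n, ?_, NatOps.bijective_orbitMap_hatIncl n⟩
  -- The unit of the monad is the unit of the Kan extension adjunction, so `he` and `he'` are
  -- already the required compatibilities with the inclusion. The isomorphisms of total complexes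
  -- are the images of `e` and `e'`, and functoriality carries the compatibilities over.
  · obtain ⟨e, he⟩ := NatOps.exists_lan_iso NatOps.joyal.rightOp (NatOps.incl n) (Y := NatOps.BS n)
    obtain ⟨e', he'⟩ := NatOps.exists_lan_iso NatOps.joyal.rightOp
      (Functor.whiskerRight (NatOps.incl n) (NatOps.simpLowerTot n))
      (Y := NatOps.BS n ⋙ NatOps.simpLowerTot n)
    refine ⟨e, e', NatOps.simpUpperTot.mapIso (Functor.isoWhiskerRight
        (Functor.isoWhiskerLeft NatOps.joyal.rightOp e) (NatOps.simpLowerTot n)),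
      NatOps.simpUpperTot.mapIso (Functor.isoWhiskerLeft NatOps.joyal.rightOp e'),
      he, he', rfl, rfl, ?_, ?_⟩
    · refine (NatOps.simpUpperTot.map_comp _ _).symm.trans (congrArg _ ?_)
      refine (Functor.whiskerRight_comp _ _ _).symm.trans ?_
      exact congrArg (fun f => Functor.whiskerRight f (NatOps.simpLowerTot n)) he
    · exact (NatOps.simpUpperTot.map_comp _ _).symm.trans (congrArg _ he')
  · obtain ⟨e, he⟩ := NatOps.exists_lan_iso NatOps.joyalInj.rightOp (NatOps.hatIncl n)
      (Y := NatOps.hatBS n)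
    obtain ⟨e', he'⟩ := NatOps.exists_lan_iso NatOps.joyalInj.rightOp
      (Functor.whiskerRight (NatOps.hatIncl n) (NatOps.lowerTot n))
      (Y := NatOps.hatBS n ⋙ NatOps.lowerTot n)
    refine ⟨e, e', NatOps.upperTot.mapIso (Functor.isoWhiskerRight
        (Functor.isoWhiskerLeft NatOps.joyalInj.rightOp e) (NatOps.lowerTot n)),
      NatOps.upperTot.mapIso (Functor.isoWhiskerLeft NatOps.joyalInj.rightOp e'),
      he, he', rfl, rfl, ?_, ?_⟩
    · refine (NatOps.upperTot.map_comp _ _).symm.trans (congrArg _ ?_)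
      refine (Functor.whiskerRight_comp _ _ _).symm.trans ?_
      exact congrArg (fun f => Functor.whiskerRight f (NatOps.lowerTot n)) he
    · exact (NatOps.upperTot.map_comp _ _).symm.trans (congrArg _ he')
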